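/- Let $D$ be an integral domain with quotient field $K$ and let $\star$ be a semistar operation on $D$, i.e. a map $E\mapsto E^\star$ on the set of nonzero $D$-submodules of $K$ such that, for all nonzero $x\in K$ and all nonzero $D$-submodules $E,F$ of $K$: $(xE)^\star=xE^\star$; $E\subseteq F$ implies $E^\star\subseteq F^\star$; $E\subseteq E^\star$ and $(E^\star)^\star=E^\star$. Let $E^{\star_f}$ be the union of the $F^\star$ over all nonzero finitely generated $D$-submodules $F\subseteq E$. A quasi-$\star$-ideal of $D$ is a nonzero ideal $I$ of $D$ with $I^\star\cap D=I$; $\operatorname{QSpec}^\star(D)$ is the set of prime quasi-$\star$-ideals (quasi-$\star$-primes), and $\operatorname{QMax}^\star(D)$ the set of maximal elements of the set of proper quasi-$\star$-ideals (they are prime). Let $\widetilde\star$ be the semistar operation $E^{\widetilde\star}:=\bigcap\{ED_P\mid P\in\operatorname{QMax}^{\star_f}(D)\}$ (which is $K$ if $\operatorname{QMax}^{\star_f}(D)=\emptyset$). The domain $D$ is $\star$-Noetherian if it satisfies the ascending chain condition on quasi-$\star$-ideals. It is $\star$-quasi-Prüfer if, whenever $Q$ is a prime ideal of $D[X]$ with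 $Q\subseteq P[X]$ for some $P\in\operatorname{QSpec}^\star(D)$, one has $Q=(Q\cap D)[X]$. The semistar operation $\star[X]$ on $D[X]$ is $E^{\star[X]}:=E[Y]_{\mathfrak S}\cap K(X)$, where $\mathfrak S:=D[X][Y]\setminus\bigcup\{Q[Y]\mid Q\in\Theta\}$ and $\Theta$ is the set of prime ideals $Q$ of $D[X]$ with $Q\cap D=(0)$ or $(Q\cap D)^{\star_f}\subsetneq D^\star$. Put $D[n]:=D[X_1,\dots,X_n]$, $\star[1]:=\star[X_1]$ and $\star[n]:=(\star[n-1])[X_n]$ for $n\ge2$. The domain $D$ is a $\star$-strong S-domain if for every pair $P_1\subsetneq P_2$ of adjacent elements of $\operatorname{QSpec}^\star(D)\cup\{(0)\}$ (that is, with no element of this set strictly between them), $P_1[X]\subsetneq P_2[X]$ are adjacent elements of $\operatorname{QSpec}^{\star[X]}(D[X])\cup\{(0)\}$. It is a $\star$-stably strong S-domain if $D[n]$ is a $\star[n]$-strong S-domain for each $n\ge1$. **Corollary.** If $D$ is $\widetilde\star$-Noetherian, then $D$ is a $\widetilde\star$-stably strong S-domain. If $D$ is $\widetilde\star$-quasi-Prüfer,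 then $D$ is a $\widetilde\star$-stably strong S-domain. -/

import Mathlib

open Polynomial
open scoped Pointwise

universe u v

/-- A semistar operation on a domain `D` with quotient field `K`: a map on the nonzero
`D`-submodules of `K`.  It is presented as a total map on `Submodule D K` whose value at the zero
module is unconstrained and never used; the three axioms concern nonzero submodules only. -/
structure SemistarOperation (D : Type u) (K : Type v) [CommRing D] [Field K] [Algebra D K] where
  /-- The underlying map `E ↦ E^⋆`. -/
  toFun : Submodule D K → Submodule D K
  smul_eq : ∀ (x : K) (E : Submodule D K), x ≠ 0 → E ≠ ⊥ → toFun (x • E) = x • toFun E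
  mono : ∀ E F : Submodule D K, E ≠ ⊥ → E ≤ F → toFun E ≤ toFun F
  le_self : ∀ E : Submodule D K, E ≠ ⊥ → E ≤ toFun E
  idem : ∀ E : Submodule D K, E ≠ ⊥ → toFun (toFun E) = toFun E

namespace SemistarOperation

instance instCoeFun {D : Type u} {K : Type v} [CommRing D] [Field K] [Algebra D K] :
    CoeFun (SemistarOperation D K) fun _ => Submodule D K → Submodule D K :=
  ⟨toFun⟩

section Basic

variable {D : Type u} {K : Type v} [CommRing D] [Field K] [Algebra D K]

theorem ne_bot_of_le {E F : Submodule D K} (hE : E ≠ ⊥) (h : E ≤ F) : F ≠ ⊥ :=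
  fun hF => hE (le_bot_iff.mp (hF ▸ h))

theorem smul_ne_bot {E : Submodule D K} {x : K} (hx : x ≠ 0) (hE : E ≠ ⊥) : x • E ≠ ⊥ := by
  obtain ⟨e, he, he0⟩ := (Submodule.ne_bot_iff E).mp hE
  exact (Submodule.ne_bot_iff _).mpr
    ⟨x • e, Submodule.smul_mem_pointwise_smul e x E he, smul_ne_zero hx he0⟩

/-- To check `(xE)^⋆ = x E^⋆` for all nonzero `x`, one inclusion is enough. -/
theorem smul_eq_of_le {f : Submodule D K → Submodule D K}
    (h : ∀ (x : K) (E : Submodule D K), x ≠ 0 → E ≠ ⊥ → x • f E ≤ f (x • E))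
    (x : K) (E : Submodule D K) (hx : x ≠ 0) (hE : E ≠ ⊥) : f (x • E) = x • f E := by
  refine le_antisymm ?_ (h x E hx hE)
  have h1 := h x⁻¹ (x • E) (inv_ne_zero hx) (smul_ne_bot hx hE)
  rw [smul_smul, inv_mul_cancel₀ hx, one_smul] at h1
  intro y hy
  rw [Submodule.mem_smul_pointwise_iff_exists]
  refine ⟨x⁻¹ • y, h1 (Submodule.smul_mem_pointwise_smul y _ _ hy), ?_⟩
  rw [smul_smul, mul_inv_cancel₀ hx, one_smul]

/-! ### The semistar operation of finite type `⋆_f` -/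

/-- The nonzero finitely generated fractional ideals contained in `E` (a finitely generated
`D`-submodule of the quotient field is automatically fractional). -/
def fgBelow (E : Submodule D K) : Set (Submodule D K) :=
  {F | F.FG ∧ F ≠ ⊥ ∧ F ≤ E}

theorem fgBelow_nonempty {E : Submodule D K} (hE : E ≠ ⊥) : (fgBelow E).Nonempty := by
  obtain ⟨e, he, he0⟩ := (Submodule.ne_bot_iff E).mp hE
  refine ⟨Submodule.span D {e}, Submodule.fg_span_singleton e, ?_, ?_⟩
  · simpa using he0
  · simpa using he

theorem directedOn_fgBelow (star : SemistarOperation D K) (E : Submodule D K) :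
    DirectedOn (· ≤ ·) (star '' fgBelow E) := by
  rintro _ ⟨F, hF, rfl⟩ _ ⟨G, hG, rfl⟩
  have hFG : F ⊔ G ≠ ⊥ := ne_bot_of_le hF.2.1 le_sup_left
  exact ⟨star (F ⊔ G), ⟨F ⊔ G, ⟨hF.1.sup hG.1, hFG, sup_le hF.2.2 hG.2.2⟩, rfl⟩,
    star.mono _ _ hF.2.1 le_sup_left, star.mono _ _ hG.2.1 le_sup_right⟩

/-- For nonzero `E`, the supremum of the `F^⋆` is their union. -/
theorem mem_sSup_fgBelow (star : SemistarOperation D K) {E : Submodule D K} (hE : E ≠ ⊥) {x : K} :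
    x ∈ sSup (star '' fgBelow E) ↔ ∃ F, F.FG ∧ F ≠ ⊥ ∧ F ≤ E ∧ x ∈ star F := by
  rw [Submodule.mem_sSup_of_directed ((fgBelow_nonempty hE).image _) (directedOn_fgBelow star E)]
  constructor
  · rintro ⟨_, ⟨F, hF, rfl⟩, hx⟩
    exact ⟨F, hF.1, hF.2.1, hF.2.2, hx⟩
  · rintro ⟨F, h1, h2, h3, hx⟩
    exact ⟨_, ⟨F, ⟨h1, h2, h3⟩, rfl⟩, hx⟩

theorem le_sSup_fgBelow (star : SemistarOperation D K) {E : Submodule D K} (hE : E ≠ ⊥) :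
    E ≤ sSup (star '' fgBelow E) := by
  intro e he
  rw [mem_sSup_fgBelow star hE]
  obtain ⟨F, hF1, hF2, hF3⟩ := fgBelow_nonempty hE
  have h2 : F ⊔ Submodule.span D {e} ≠ ⊥ := ne_bot_of_le hF2 le_sup_left
  refine ⟨F ⊔ Submodule.span D {e}, hF1.sup (Submodule.fg_span_singleton e), h2,
    sup_le hF3 (by simpa using he), star.le_self _ h2 ?_⟩
  exact (le_sup_right : Submodule.span D {e} ≤ _) (Submodule.mem_span_singleton_self e)

/-- The semistar operation of finite type `⋆_f` associated to `⋆`: `E^{⋆_f}` is the union of the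
`F^⋆`, where `F` runs over the nonzero finitely generated `F ⊆ E` (see `mem_finiteType`). -/
def finiteType (star : SemistarOperation D K) : SemistarOperation D K where
  toFun E := sSup (star '' fgBelow E)
  smul_eq := by
    refine smul_eq_of_le (f := fun E => sSup (star.toFun '' fgBelow E)) ?_
    intro x E hx hE y hy
    rw [Submodule.mem_smul_pointwise_iff_exists] at hy
    obtain ⟨z, hz, rfl⟩ := hy
    obtain ⟨F, h1, h2, h3, hz⟩ := (mem_sSup_fgBelow star hE).mp hz
    refine (mem_sSup_fgBelow star (smul_ne_bot hx hE)).mpr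
      ⟨x • F, ?_, smul_ne_bot hx h2, smul_mono_right x h3, ?_⟩
    · exact h1.map _
    · rw [star.smul_eq x F hx h2]
      exact Submodule.smul_mem_pointwise_smul z x _ hz
  mono E F _ hEF :=
    sSup_le_sSup (Set.image_mono fun _ hG => ⟨hG.1, hG.2.1, hG.2.2.trans hEF⟩)
  le_self E hE := le_sSup_fgBelow star hE
  idem E hE := by
    have hE' := ne_bot_of_le hE (le_sSup_fgBelow star hE)
    refine le_antisymm ?_ (le_sSup_fgBelow star hE')
    intro x hx
    obtain ⟨F, h1, h2, h3, hx⟩ := (mem_sSup_fgBelow star hE').mp hx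
    obtain ⟨_, ⟨G, hG, rfl⟩, hFG⟩ :=
      (CompleteLattice.isCompactElement_iff_le_of_directed_sSup_le _ F).mp
        ((Submodule.fg_iff_compact F).mp h1) _ ((fgBelow_nonempty hE).image _)
        (directedOn_fgBelow star E) h3
    refine (mem_sSup_fgBelow star hE).mpr ⟨G, hG.1, hG.2.1, hG.2.2, ?_⟩
    rw [← star.idem G hG.2.1]
    exact star.mono _ _ h2 hFG hx

theorem mem_finiteType (star : SemistarOperation D K) {E : Submodule D K} (hE : E ≠ ⊥) {x : K} :
    x ∈ star.finiteType E ↔ ∃ F, F.FG ∧ F ≠ ⊥ ∧ F ≤ E ∧ x ∈ star F :=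
  mem_sSup_fgBelow star hE

/-! ### Quasi-`⋆`-ideals -/

/-- A quasi-`⋆`-ideal: a nonzero ideal `I` of `D` with `I^⋆ ∩ D = I`. -/
def IsQuasiIdeal (star : SemistarOperation D K) (I : Ideal D) : Prop :=
  I ≠ ⊥ ∧ (star (IsLocalization.coeSubmodule K I)).comap (Algebra.linearMap D K) = I

/-- A quasi-`⋆`-prime ideal, i.e. an element of `QSpec^⋆(D)`; in particular it is nonzero. -/
def IsQuasiPrime (star : SemistarOperation D K) (P : Ideal D) : Prop :=
  P.IsPrime ∧ star.IsQuasiIdeal P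

/-- A quasi-`⋆`-maximal ideal, i.e. an element of `QMax^⋆(D)`: a maximal element of the set of
proper quasi-`⋆`-ideals. -/
def IsQuasiMaximal (star : SemistarOperation D K) (M : Ideal D) : Prop :=
  Maximal (fun I : Ideal D => I ≠ ⊤ ∧ star.IsQuasiIdeal I) M

/-! ### Spectral semistar operations and `⋆̃` -/

/-- `E D_P`, the `D`-submodule `{e / s : e ∈ E, s ∈ D \ P}` of `K`. -/
def localize (E : Submodule D K) (P : PrimeSpectrum D) : Submodule D K where
  carrier := {x | ∃ s : D, s ∉ P.asIdeal ∧ s • x ∈ E}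
  zero_mem' := ⟨1, (Ideal.ne_top_iff_one _).mp P.isPrime.ne_top, by simp⟩
  add_mem' := by
    rintro x y ⟨s, hs, hx⟩ ⟨t, ht, hy⟩
    refine ⟨s * t, fun h => (P.isPrime.mem_or_mem h).elim hs ht, ?_⟩
    rw [smul_add]
    refine E.add_mem ?_ ?_
    · rw [mul_comm, mul_smul]
      exact E.smul_mem t hx
    · rw [mul_smul]
      exact E.smul_mem s hy
  smul_mem' := by
    rintro c x ⟨s, hs, hx⟩
    exact ⟨s, hs, by rw [smul_comm]; exact E.smul_mem c hx⟩

theorem le_localize (E : Submodule D K) (P : PrimeSpectrum D) : E ≤ localize E P :=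
  fun x hx => ⟨1, (Ideal.ne_top_iff_one _).mp P.isPrime.ne_top, by simpa using hx⟩

theorem localize_mono {E F : Submodule D K} (h : E ≤ F) (P : PrimeSpectrum D) :
    localize E P ≤ localize F P :=
  fun _ ⟨s, hs, hx⟩ => ⟨s, hs, h hx⟩

/-- The spectral semistar operation `⋆_Δ` associated to a set `Δ` of primes of `D`:
`E^{⋆_Δ} = ⋂ {E D_P | P ∈ Δ}`, which is `K` if `Δ` is empty. -/
def spectral (Δ : Set (PrimeSpectrum D)) : SemistarOperation D K where
  toFun E := ⨅ P ∈ Δ, localize E P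
  smul_eq := by
    refine smul_eq_of_le (f := fun E => ⨅ P ∈ Δ, localize E P) ?_
    intro x E hx hE y hy
    rw [Submodule.mem_smul_pointwise_iff_exists] at hy
    obtain ⟨z, hz, rfl⟩ := hy
    simp only [Submodule.mem_iInf] at hz ⊢
    intro P hP
    obtain ⟨s, hs, h⟩ := hz P hP
    refine ⟨s, hs, ?_⟩
    rw [smul_comm]
    exact Submodule.smul_mem_pointwise_smul _ _ _ h
  mono E F _ h := iInf₂_mono fun P _ => localize_mono h P
  le_self E _ := le_iInf₂ fun P _ => le_localize E P
  idem E _ := by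
    refine le_antisymm (iInf₂_mono fun P hP => ?_) (le_iInf₂ fun P _ => le_localize _ P)
    rintro x ⟨s, hs, hx⟩
    obtain ⟨t, ht, htx⟩ := (iInf₂_le P hP : (⨅ P ∈ Δ, localize E P) ≤ _) hx
    exact ⟨t * s, fun h => (P.isPrime.mem_or_mem h).elim ht hs, by rwa [mul_smul]⟩

/-- The operation `⋆̃`: the spectral semistar operation associated to `QMax^{⋆_f}(D)`.
(Quasi-`⋆_f`-maximal ideals are prime, so all of them occur here:
see `IsQuasiMaximal.isPrime`.) -/
def tilde (star : SemistarOperation D K) : SemistarOperation D K :=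
  spectral {P | star.finiteType.IsQuasiMaximal P.asIdeal}

/-! ### Properties of a domain relative to a semistar operation -/

/-- `D` is `⋆`-Noetherian: the ascending chain condition on quasi-`⋆`-ideals. -/
def IsNoetherianDomain (star : SemistarOperation D K) : Prop :=
  WellFoundedGT {I : Ideal D // star.IsQuasiIdeal I}

/-- `D` is `⋆`-quasi-Prüfer: every prime `Q` of `D[X]` with `Q ⊆ P[X]` for some
`P ∈ QSpec^⋆(D)` satisfies `Q = (Q ∩ D)[X]`. -/
def IsQuasiPruferDomain (star : SemistarOperation D K) : Prop :=
  ∀ Q : Ideal D[X], Q.IsPrime → ∀ P : Ideal D, star.IsQuasiPrime P →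
    Q ≤ P.map (C : D →+* D[X]) →
      Q = (Q.comap (C : D →+* D[X])).map (C : D →+* D[X])

/-- `P₁ ⊂ P₂` are adjacent elements of `QSpec^⋆(D) ∪ {0}`. -/
structure IsAdjacent (star : SemistarOperation D K) (P₁ P₂ : Ideal D) : Prop where
  left : P₁ = ⊥ ∨ star.IsQuasiPrime P₁
  right : star.IsQuasiPrime P₂
  lt : P₁ < P₂
  not_between : ∀ Q : Ideal D, star.IsQuasiPrime Q → P₁ < Q → ¬ Q < P₂

/-! ### The semistar operation `⋆[X]` on `D[X]` -/

/-- `Θ₁^⋆`, the set of primes `Q` of `D[X]` with `Q ∩ D = 0` or `(Q ∩ D)^{⋆_f} ⊊ D^⋆`. -/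
def theta (star : SemistarOperation D K) : Set (PrimeSpectrum D[X]) :=
  {Q | Q.asIdeal.comap (C : D →+* D[X]) = ⊥ ∨
    star.finiteType (IsLocalization.coeSubmodule K (Q.asIdeal.comap (C : D →+* D[X]))) <
      star (IsLocalization.coeSubmodule K ⊤)}

/-- The multiplicative set `D[X][Y] \ ⋃ {Q[Y] | Q ∈ Θ₁^⋆}`. -/
def thetaCompl (star : SemistarOperation D K) : Submonoid D[X][X] where
  carrier := {s | ∀ Q ∈ star.theta, s ∉ Q.asIdeal.map (C : D[X] →+* D[X][X])}
  one_mem' Q _ :=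
    (Ideal.ne_top_iff_one _).mp (Ideal.isPrime_map_C_of_isPrime (P := Q.asIdeal)).ne_top
  mul_mem' hs ht Q hQ h :=
    ((Ideal.isPrime_map_C_of_isPrime (P := Q.asIdeal)).mem_or_mem h).elim (hs Q hQ) (ht Q hQ)

end Basic

/-- For a domain `A`, a multiplicative set `S ⊆ A[Y] \ {0}` and an `A`-submodule `E` of the
quotient field `L` of `A`, the `A`-module `E[Y]_S ∩ L`: an element `x` of `L` has the form `f / s`
with `f ∈ E[Y]` and `s ∈ S` iff some `s ∈ S` has `x s ∈ E[Y]`, that is, all coefficients of the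
polynomial `x s ∈ L[Y]` lie in `E`. -/
def nagata {A : Type u} {L : Type v} [CommRing A] [Field L] [Algebra A L]
    (S : Submonoid A[X]) (E : Submodule A L) : Submodule A L where
  carrier := {x | ∃ s ∈ S, ∀ i, (C x * s.map (algebraMap A L)).coeff i ∈ E}
  zero_mem' := ⟨1, S.one_mem, by simp⟩
  add_mem' := by
    rintro x y ⟨s, hs, hx⟩ ⟨t, ht, hy⟩
    refine ⟨s * t, S.mul_mem hs ht, fun i => ?_⟩
    have h1 : C (x + y) * (s * t).map (algebraMap A L) =
        C x * s.map (algebraMap A L) * t.map (algebraMap A L) +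
          C y * t.map (algebraMap A L) * s.map (algebraMap A L) := by
      rw [Polynomial.map_mul, C_add]; ring
    rw [h1, coeff_add, coeff_mul, coeff_mul]
    refine E.add_mem (E.sum_mem fun p _ => ?_) (E.sum_mem fun p _ => ?_)
    · rw [coeff_map, mul_comm, ← Algebra.smul_def]
      exact E.smul_mem _ (hx _)
    · rw [coeff_map (n := p.2), mul_comm, ← Algebra.smul_def]
      exact E.smul_mem _ (hy _)
  smul_mem' := by
    rintro c x ⟨s, hs, hx⟩
    refine ⟨s, hs, fun i => ?_⟩
    have := E.smul_mem c (hx i)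
    rw [coeff_C_mul] at this ⊢
    rwa [smul_mul_assoc]

theorem mem_nagata {A : Type u} {L : Type v} [CommRing A] [Field L] [Algebra A L]
    {S : Submonoid A[X]} {E : Submodule A L} {x : L} :
    x ∈ nagata S E ↔ ∃ s ∈ S, ∀ i, s.coeff i • x ∈ E := by
  refine exists_congr fun s => and_congr_right fun _ => forall_congr' fun i => ?_
  rw [coeff_C_mul, coeff_map, mul_comm, ← Algebra.smul_def]

theorem le_nagata {A : Type u} {L : Type v} [CommRing A] [Field L] [Algebra A L]
    (S : Submonoid A[X]) (E : Submodule A L) : E ≤ nagata S E := by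
  intro x hx
  exact mem_nagata.mpr ⟨1, S.one_mem, fun i => E.smul_mem _ hx⟩

theorem nagata_nagata_le {A : Type u} {L : Type v} [CommRing A] [Field L] [Algebra A L]
    (S : Submonoid A[X]) (E : Submodule A L) : nagata S (nagata S E) ≤ nagata S E := by
  intro x hx
  obtain ⟨s, hs, hx⟩ := mem_nagata.mp hx
  choose t ht htx using fun i => mem_nagata.mp (hx i)
  -- one denominator for finitely many coefficients of `s`
  have key : ∀ J : Finset ℕ, ∃ r ∈ S, ∀ i ∈ J, ∀ j, r.coeff j • s.coeff i • x ∈ E := by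
    intro J
    induction J using Finset.induction_on with
    | empty => exact ⟨1, S.one_mem, by simp⟩
    | insert a J _ ih =>
      obtain ⟨r, hr, h⟩ := ih
      refine ⟨t a * r, S.mul_mem (ht a) hr, fun i hi j => ?_⟩
      rw [coeff_mul, Finset.sum_smul]
      refine E.sum_mem fun p _ => ?_
      rcases Finset.mem_insert.mp hi with rfl | hi
      · rw [mul_comm, mul_smul]
        exact E.smul_mem _ (htx _ _)
      · rw [mul_smul]
        exact E.smul_mem _ (h i hi _)
  obtain ⟨r, hr, h⟩ := key s.support
  refine mem_nagata.mpr ⟨r * s, S.mul_mem hr hs, fun i => ?_⟩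
  rw [coeff_mul, Finset.sum_smul]
  refine E.sum_mem fun p _ => ?_
  rw [mul_smul]
  by_cases hp : p.2 ∈ s.support
  · exact h _ hp _
  · simp [notMem_support_iff.mp hp]

section Polynomial

variable {D : Type u} {K : Type v} [CommRing D] [Field K] [Algebra D K]

/-- The semistar operation `⋆[X]` on `D[X]`: with `S = D[X][Y] \ ⋃ {Q[Y] | Q ∈ Θ₁^⋆}` and `K₁` the
quotient field of `D[X]`, it is the map `E ↦ E[Y]_S ∩ K₁`. -/
noncomputable def polynomial (star : SemistarOperation D K) (K₁ : Type u) [Field K₁] [Algebra D[X] K₁] :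
    SemistarOperation D[X] K₁ where
  toFun E := nagata star.thetaCompl E
  smul_eq := by
    refine smul_eq_of_le (f := fun E => nagata star.thetaCompl E) ?_
    intro x E hx hE y hy
    rw [Submodule.mem_smul_pointwise_iff_exists] at hy
    obtain ⟨z, hz, rfl⟩ := hy
    obtain ⟨s, hs, h⟩ := mem_nagata.mp hz
    refine mem_nagata.mpr ⟨s, hs, fun i => ?_⟩
    rw [smul_comm]
    exact Submodule.smul_mem_pointwise_smul _ _ _ (h i)
  mono E F _ h x := fun ⟨s, hs, hx⟩ => ⟨s, hs, fun i => h (hx i)⟩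
  le_self E _ := le_nagata _ E
  idem E _ := le_antisymm (nagata_nagata_le _ E) (le_nagata _ _)

/-- `D` is a `⋆`-strong S-domain: each pair of adjacent elements `P₁ ⊂ P₂` of `QSpec^⋆(D) ∪ {0}`
extends to a pair of adjacent elements `P₁[X] ⊂ P₂[X]` of `QSpec^{⋆[X]}(D[X]) ∪ {0}`. -/
def IsStrongSDomain [IsDomain D] (star : SemistarOperation D K) : Prop :=
  ∀ P₁ P₂ : Ideal D, star.IsAdjacent P₁ P₂ →
    (star.polynomial (FractionRing D[X])).IsAdjacent
      (P₁.map (C : D →+* D[X])) (P₂.map (C : D →+* D[X]))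

end Polynomial

/-- `D[n] = D[X₁, …, X_n]` is a `⋆[n]`-strong S-domain.  Here `D[n]` and `⋆[n]` arise from `D` and
`⋆` by applying the construction `(D, ⋆) ↦ (D[X], ⋆[X])` `n` times. -/
def IsStrongSDomainAfter : (n : ℕ) → {D K : Type u} → [CommRing D] → [IsDomain D] → [Field K] →
    [Algebra D K] → SemistarOperation D K → Prop
  | 0, _, _, _, _, _, _, star => star.IsStrongSDomain
  | n + 1, D, _, _, _, _, _, star =>
      IsStrongSDomainAfter n (star.polynomial (FractionRing D[X]))

/-- `D` is a `⋆`-stably strong S-domain: `D[n]` is a `⋆[n]`-strong S-domain for each `n ≥ 1`. -/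
def IsStablyStrongSDomain {D K : Type u} [CommRing D] [IsDomain D] [Field K] [Algebra D K]
    (star : SemistarOperation D K) : Prop :=
  ∀ n : ℕ, 1 ≤ n → IsStrongSDomainAfter n star

/-- Quasi-`⋆`-maximal ideals are prime. -/
theorem IsQuasiMaximal.isPrime {D : Type u} {K : Type v} [CommRing D] [IsDomain D] [Field K]
    [Algebra D K] [IsFractionRing D K] {star : SemistarOperation D K} {M : Ideal D}
    (hM : star.IsQuasiMaximal M) : M.IsPrime := by
  obtain ⟨⟨hM1, hM0, hMq⟩, hmax⟩ := hM
  have hinj : Function.Injective (algebraMap D K) := IsFractionRing.injective D K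
  have hcoe : ∀ I : Ideal D, I ≠ ⊥ → IsLocalization.coeSubmodule K I ≠ ⊥ := by
    intro I hI
    obtain ⟨a, ha, ha0⟩ := (Submodule.ne_bot_iff I).mp hI
    exact (Submodule.ne_bot_iff _).mpr ⟨algebraMap D K a,
      (IsLocalization.mem_coeSubmodule K I).mpr ⟨a, ha, rfl⟩,
      fun h => ha0 (hinj (h.trans (map_zero _).symm))⟩
  refine ⟨hM1, fun {a b} hab => ?_⟩
  by_contra! hcon
  obtain ⟨ha, hb⟩ := hcon
  set I : Ideal D := M ⊔ Ideal.span {a} with hI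
  have hMI : M ≤ I := le_sup_left
  have hI0 : I ≠ ⊥ := fun h => hM0 (le_bot_iff.mp (h ▸ hMI))
  set J : Ideal D :=
    (star (IsLocalization.coeSubmodule K I)).comap (Algebra.linearMap D K) with hJ
  have hIJ : I ≤ J := fun y hy => star.le_self _ (hcoe I hI0)
    ((IsLocalization.mem_coeSubmodule K I).mpr ⟨y, hy, rfl⟩)
  have hJ0 : J ≠ ⊥ := fun h => hI0 (le_bot_iff.mp (h ▸ hIJ))
  have hJq : star.IsQuasiIdeal J := by
    refine ⟨hJ0, le_antisymm ?_ ?_⟩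
    · refine Submodule.comap_mono ?_
      rw [← star.idem _ (hcoe I hI0)]
      refine star.mono _ _ (hcoe J hJ0) ?_
      intro y hy
      obtain ⟨z, hz, rfl⟩ := (IsLocalization.mem_coeSubmodule K J).mp hy
      exact hz
    · intro y hy
      exact star.le_self _ (hcoe J hJ0) ((IsLocalization.mem_coeSubmodule K J).mpr ⟨y, hy, rfl⟩)
  have haI : a ∈ I := (le_sup_right : Ideal.span {a} ≤ I) (Ideal.mem_span_singleton_self a)
  have hJtop : J = ⊤ := by
    by_contra h
    exact ha (hmax ⟨h, hJq⟩ (hMI.trans hIJ) (hIJ haI))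
  have hone : (1 : K) ∈ star (IsLocalization.coeSubmodule K I) := by
    have : (1 : D) ∈ J := hJtop ▸ Submodule.mem_top
    simpa [hJ] using this
  have hb0 : algebraMap D K b ≠ 0 := by
    intro h
    have h' : b = 0 := hinj (h.trans (map_zero _).symm)
    exact hb (h' ▸ M.zero_mem)
  have hbmem : algebraMap D K b ∈ star (algebraMap D K b • IsLocalization.coeSubmodule K I) := by
    rw [star.smul_eq _ _ hb0 (hcoe I hI0)]
    have := Submodule.smul_mem_pointwise_smul (1 : K) (algebraMap D K b) _ hone
    simpa using this
  have hle : algebraMap D K b • IsLocalization.coeSubmodule K I ≤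
      IsLocalization.coeSubmodule K M := by
    intro y hy
    rw [Submodule.mem_smul_pointwise_iff_exists] at hy
    obtain ⟨z, hz, rfl⟩ := hy
    obtain ⟨c, hc, rfl⟩ := (IsLocalization.mem_coeSubmodule K I).mp hz
    refine (IsLocalization.mem_coeSubmodule K M).mpr ⟨b * c, ?_, by simp⟩
    obtain ⟨m, hm, d, hd, rfl⟩ := Submodule.mem_sup.mp hc
    obtain ⟨e, rfl⟩ := Ideal.mem_span_singleton'.mp hd
    have : b * (m + e * a) = b * m + e * (a * b) := by ring
    rw [this]
    exact M.add_mem (M.mul_mem_left b hm) (M.mul_mem_left e hab)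
  have := star.mono _ _ (smul_ne_bot hb0 (hcoe I hI0)) hle hbmem
  have hbM : b ∈ (star (IsLocalization.coeSubmodule K M)).comap (Algebra.linearMap D K) := this
  rw [hMq] at hbM
  exact hb hbM

end SemistarOperation

/-!
The primes on which `⋆̃` is proper form a lower set of `Spec D`: apart from `0` they are the
quasi-`⋆̃`-primes, and the corresponding set for `⋆̃[X]` is its full preimage in `Spec D[X]`. Hence
adjacency in `QSpec ∪ {0}` is adjacency in `Spec`, and everything reduces to a statement without
semistar operations: adjacent primes of `D[X₁, …, Xₙ]`, the larger one lying over a prime `P` in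
this set, stay adjacent after adjoining one more variable. Passing to the quotient by the smaller
prime, this says that in a domain `B` of finite type over `D` a height-one prime `N` over `P`
extends to a height-one prime `N[X]`.

If `⋆̃` is Noetherian, then `D_P` is Noetherian, hence so is `B_N`, and `N[X]` has the height of
`N`. If `⋆̃` is quasi-Prüfer, replace `D` by its image in `B`; the case `N ∩ D = 0` is Noetherian.
Otherwise a nonzero prime `q ⊆ N[X]` with `q ∩ B = 0` would give `E = B[X]/q`, algebraic over `B`,
with a surjection `E → (B/N)[X]`. Dominating by a valuation ring, where polynomials have a
coefficient dividing all the others, the quasi-Prüfer condition shows that transcendence degrees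
over `D` do not increase from `E` to `(B/N)[X]`, so `trdeg (B/N) + 1 ≤ trdeg B`. But `B` is
quasi-finite at `N` over the subalgebra generated by lifts of a transcendence basis of `B/N`, so
`trdeg B ≤ trdeg (B/N)`.
-/

section PolynomialExtension

variable {R S : Type*} [CommRing R] [CommRing S]

/-- The prime ideal `P[X]` of `R[X]`, for a prime ideal `P` of `R`. -/
noncomputable def polynomialExtension (P : PrimeSpectrum R) : PrimeSpectrum R[X] :=
  ⟨P.asIdeal.map C, Ideal.isPrime_map_C_of_isPrime⟩

theorem comap_C_polynomialExtension (P : PrimeSpectrum R) :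
    (polynomialExtension P).comap C = P := by
  refine PrimeSpectrum.ext (Ideal.ext fun a => ?_)
  change C a ∈ P.asIdeal.map C ↔ a ∈ P.asIdeal
  refine ⟨fun h => ?_, Ideal.mem_map_of_mem C⟩
  simpa using Ideal.mem_map_C_iff.mp h 0

theorem monotone_comap_C : Monotone (PrimeSpectrum.comap (C : R →+* R[X])) :=
  fun _ _ h => Ideal.comap_mono h

theorem polynomialExtension_le_iff {P : PrimeSpectrum R} {Q : PrimeSpectrum R[X]} :
    polynomialExtension P ≤ Q ↔ P ≤ Q.comap C :=
  Ideal.map_le_iff_le_comap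

theorem polynomialExtension_comap (f : R →+* S) (P : PrimeSpectrum S) :
    polynomialExtension (P.comap f) = (polynomialExtension P).comap (mapRingHom f) := by
  refine PrimeSpectrum.ext (Ideal.ext fun p => ?_)
  simp [polynomialExtension, Ideal.mem_map_C_iff]

theorem comap_covBy_comap_iff {f : R →+* S} (hf : Function.Surjective f)
    {P Q : PrimeSpectrum S} : P.comap f ⋖ Q.comap f ↔ P ⋖ Q := by
  let e : PrimeSpectrum S ↪o PrimeSpectrum R :=
    { toFun := PrimeSpectrum.comap f
      inj' := PrimeSpectrum.comap_injective_of_surjective f hf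
      map_rel_iff' := Ideal.comap_le_comap_iff_of_surjective f hf _ _ }
  refine Set.OrdConnected.apply_covBy_apply_iff e ?_
  change (Set.range (PrimeSpectrum.comap f)).OrdConnected
  rw [range_comap_of_surjective _ f hf]
  exact ⟨fun _ hP _ _ _ hQ => Set.Subset.trans hP hQ.1⟩

end PolynomialExtension

section StrongS

/-- The strong S-property of a domain, localized at the upper member of the pair: extension to
`R[X]` keeps every prime adjacent below `P` adjacent below `P[X]`. -/
def IsStrongSPrime {R : Type*} [CommRing R] (P : PrimeSpectrum R) : Prop :=
  ∀ Q, Q ⋖ P → polynomialExtension Q ⋖ polynomialExtension P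

/-- The strong S-property for all primes over `P` in all `D`-algebras of finite type. Unlike
`IsStrongSPrime` it passes from `P` to the primes of `D[X]` over `P`, hence to `D[X₁, …, Xₙ]`. -/
def IsUniversallyStrongSPrime {D : Type u} [CommRing D] (P : PrimeSpectrum D) : Prop :=
  ∀ (A : Type u) [CommRing A] [Algebra D A] [Algebra.FiniteType D A] (Q : PrimeSpectrum A),
    Q.comap (algebraMap D A) = P → IsStrongSPrime Q

theorem IsUniversallyStrongSPrime.isStrongSPrime {D : Type u} [CommRing D] {P : PrimeSpectrum D}
    (hP : IsUniversallyStrongSPrime P) : IsStrongSPrime P :=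
  hP D P rfl

theorem IsUniversallyStrongSPrime.of_comap_C {D : Type u} [CommRing D] {P : PrimeSpectrum D[X]}
    (hP : IsUniversallyStrongSPrime (P.comap C)) : IsUniversallyStrongSPrime P := by
  intro A _ _ _ Q hQ
  let _ : Algebra D A := Algebra.compHom A (C : D →+* D[X])
  have : IsScalarTower D D[X] A := .of_algebraMap_eq' rfl
  have : Algebra.FiniteType D A := .trans (S := D[X]) inferInstance inferInstance
  refine hP A Q ?_
  rw [← hQ]
  rfl

theorem isUniversallyStrongSPrime_of_bot_covBy {D : Type u} [CommRing D] {P : PrimeSpectrum D}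
    (h : ∀ (B : Type u) [CommRing B] [IsDomain B] [Algebra D B] [Algebra.FiniteType D B]
      (N : PrimeSpectrum B), N.comap (algebraMap D B) = P → ⊥ ⋖ N → ⊥ ⋖ polynomialExtension N) :
    IsUniversallyStrongSPrime P := by
  intro A _ _ _ P₂ hP₂ P₁ h12
  have hsurj : Function.Surjective (Ideal.Quotient.mk P₁.asIdeal) := Ideal.Quotient.mk_surjective
  obtain ⟨N, rfl⟩ : P₂ ∈ Set.range (PrimeSpectrum.comap (Ideal.Quotient.mk P₁.asIdeal)) := by
    rw [range_comap_of_surjective _ _ hsurj, Ideal.mk_ker]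
    exact h12.le
  have hP₁ : P₁ = PrimeSpectrum.comap (Ideal.Quotient.mk P₁.asIdeal) ⊥ := by
    refine PrimeSpectrum.ext ?_
    exact (Ideal.mk_ker (I := P₁.asIdeal)).symm
  have hbot : polynomialExtension (⊥ : PrimeSpectrum (A ⧸ P₁.asIdeal)) = ⊥ :=
    PrimeSpectrum.ext Ideal.map_bot
  nth_rewrite 1 [hP₁] at h12 ⊢
  rw [polynomialExtension_comap, polynomialExtension_comap,
    comap_covBy_comap_iff (map_surjective _ hsurj), hbot]
  exact h (A ⧸ P₁.asIdeal) N hP₂ ((comap_covBy_comap_iff hsurj).mp h12)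

end StrongS

section Noetherian

theorem bot_covBy_iff_height_eq_one {α : Type*} [PartialOrder α] [OrderBot α] {a : α} :
    ⊥ ⋖ a ↔ Order.height a = 1 := by
  have hpos : ∀ b : α, 1 ≤ Order.height b ↔ ⊥ < b := fun b => by
    rw [Order.one_le_iff_pos, Order.height_pos, isMin_iff_eq_bot, bot_lt_iff_ne_bot]
  rw [← Nat.cast_one, Order.height_eq_coe_iff_minimal_le_height, minimal_iff_forall_lt,
    Nat.cast_one, hpos]
  refine and_congr_right fun _ => forall_congr' fun b => ?_
  rw [hpos]
  tauto

theorem height_map_C_of_isNoetherianRing_localization {R : Type*} [CommRing R] (P : Ideal R)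
    [P.IsPrime] [IsNoetherianRing (Localization.AtPrime P)] :
    (P.map (C : R →+* R[X])).height = P.height := by
  let S := Localization.AtPrime P
  let : Algebra R[X] S[X] := Polynomial.algebra R S
  have : IsLocalization (P.primeCompl.map (C : R →+* R[X])) S[X] :=
    Polynomial.isLocalization P.primeCompl S
  have hunder : (IsLocalRing.maximalIdeal S).under R = P :=
    IsLocalization.AtPrime.under_maximalIdeal S P
  have hunder_X : ((IsLocalRing.maximalIdeal S).map C).under R[X] = P.map C := by
    ext p
    rw [Ideal.under, Ideal.mem_comap, Polynomial.algebraMap_def, coe_mapRingHom]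
    simp only [Ideal.mem_map_C_iff, coeff_map, ← hunder, Ideal.under, Ideal.mem_comap, S]
  calc (P.map (C : R →+* R[X])).height
      = ((IsLocalRing.maximalIdeal S).map C).height := by
        rw [← hunder_X, IsLocalization.height_under (P.primeCompl.map (C : R →+* R[X]))]
    _ = (IsLocalRing.maximalIdeal S).height := Polynomial.height_map_C _
    _ = P.height := by rw [← IsLocalization.height_under P.primeCompl, hunder]

theorem isNoetherianRing_localization_bot (R : Type*) [CommRing R] [IsDomain R] :
    IsNoetherianRing (Localization.AtPrime (⊥ : Ideal R)) := by
  have : IsField (Localization.AtPrime (⊥ : Ideal R)) := by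
    rw [IsLocalRing.isField_iff_maximalIdeal_eq, ← Localization.AtPrime.map_eq_maximalIdeal,
      Ideal.map_bot]
  let := this.toField
  infer_instance

theorem isNoetherianRing_localization_of_finiteType {R S : Type*} [CommRing R] [CommRing S]
    [Algebra R S] [Algebra.FiniteType R S] (P : Ideal R) [P.IsPrime]
    [IsNoetherianRing (Localization.AtPrime P)] (N : Ideal S) [N.IsPrime] [N.LiesOver P] :
    IsNoetherianRing (Localization.AtPrime N) := by
  let := Localization.AtPrime.algebraOfLiesOver P N
  have : Algebra.EssFiniteType R (Localization.AtPrime N) := .comp R S _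
  have : Algebra.EssFiniteType (Localization.AtPrime P) (Localization.AtPrime N) :=
    .of_comp R _ _
  exact Algebra.EssFiniteType.isNoetherianRing (Localization.AtPrime P) _

theorem bot_covBy_polynomialExtension_of_isNoetherianRing {R : Type*} [CommRing R] [IsDomain R]
    {N : PrimeSpectrum R} [IsNoetherianRing (Localization.AtPrime N.asIdeal)] (hN : ⊥ ⋖ N) :
    ⊥ ⋖ polynomialExtension N := by
  rw [bot_covBy_iff_height_eq_one, ← PrimeSpectrum.height_eq_orderHeight] at hN ⊢
  exact (height_map_C_of_isNoetherianRing_localization N.asIdeal).trans hN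

theorem isUniversallyStrongSPrime_of_isNoetherianRing {D : Type u} [CommRing D]
    {P : PrimeSpectrum D} [IsNoetherianRing (Localization.AtPrime P.asIdeal)] :
    IsUniversallyStrongSPrime P := by
  refine isUniversallyStrongSPrime_of_bot_covBy fun B _ _ _ _ N hNP hN => ?_
  have : N.asIdeal.LiesOver P.asIdeal := ⟨congrArg PrimeSpectrum.asIdeal hNP.symm⟩
  have := isNoetherianRing_localization_of_finiteType P.asIdeal N.asIdeal
  exact bot_covBy_polynomialExtension_of_isNoetherianRing hN

end Noetherian

section QuasiPrufer

/-- In the usual terminology: no upper to zero of `R[X]` is contained in `P[X]`. -/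
def NoUppersBelow {R : Type*} [CommRing R] (P : Ideal R) : Prop :=
  ∀ Q : Ideal R[X], Q.IsPrime → Q.comap C = ⊥ → Q ≤ P.map C → Q = ⊥

theorem NoUppersBelow.bot_covBy_polynomialExtension {R : Type*} [CommRing R] [IsDomain R]
    {N : PrimeSpectrum R} (hN : NoUppersBelow N.asIdeal) (hcov : ⊥ ⋖ N) :
    ⊥ ⋖ polynomialExtension N := by
  have hC {Q : PrimeSpectrum R[X]} : Q.comap C = ⊥ ↔ Q.asIdeal.comap C = ⊥ :=
    PrimeSpectrum.ext_iff
  refine ⟨bot_lt_iff_ne_bot.mpr fun h => hcov.ne' ?_, fun Q hQ hQN => ?_⟩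
  · rw [← comap_C_polynomialExtension N, h, hC]
    exact Ideal.comap_bot_of_injective C C_injective
  · have hcomap : Q.comap C ≤ N :=
      (monotone_comap_C hQN.le).trans_eq (comap_C_polynomialExtension N)
    rcases hcov.eq_or_eq bot_le hcomap with h | h
    · exact hQ.ne' (PrimeSpectrum.ext (hN Q.asIdeal Q.isPrime (hC.mp h) hQN.le))
    · exact hQN.not_ge (polynomialExtension_le_iff.mpr h.ge)

theorem algebraicIndependent_quotient_iff {R S ι : Type*} [CommRing R] [CommRing S] [Algebra R S]
    (P : Ideal R) [Algebra (R ⧸ P) S] [IsScalarTower R (R ⧸ P) S] (z : ι → S) :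
    AlgebraicIndependent (R ⧸ P) z ↔
      ∀ f : MvPolynomial ι R, MvPolynomial.aeval z f = 0 → ∀ m, f.coeff m ∈ P := by
  rw [algebraicIndependent_iff,
    (MvPolynomial.map_surjective (algebraMap R (R ⧸ P)) Ideal.Quotient.mk_surjective).forall]
  simp only [MvPolynomial.aeval_map_algebraMap, MvPolynomial.ext_iff, MvPolynomial.coeff_map,
    MvPolynomial.coeff_zero]
  simp only [Ideal.Quotient.algebraMap_eq, Ideal.Quotient.eq_zero_iff_mem]

theorem NoUppersBelow.isAlgebraic_apply {R S T : Type*} [CommRing R] [CommRing S] [IsDomain S]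
    [CommRing T] [Algebra R S] [FaithfulSMul R S] [Algebra R T] {P : Ideal R}
    [Algebra (R ⧸ P) T] [IsScalarTower R (R ⧸ P) T] (hP : NoUppersBelow P) (g : S →ₐ[R] T) {x : S}
    (hx : IsAlgebraic R x) : IsAlgebraic (R ⧸ P) (g x) := by
  by_contra htr
  obtain ⟨p, hp0, hp⟩ := hx
  have hker : RingHom.ker (aeval (R := R) x) = ⊥ := by
    refine hP _ (RingHom.ker_isPrime _) ?_ fun f hf => Ideal.mem_map_C_iff.mpr fun m => ?_
    · refine le_bot_iff.mp fun a ha => FaithfulSMul.algebraMap_injective R S ?_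
      rw [map_zero, ← aeval_C]
      exact ha
    · have hgx : aeval (g x) (f.map (algebraMap R (R ⧸ P))) = 0 := by
        rw [aeval_map_algebraMap, aeval_algHom_apply, hf, map_zero]
      have hfm := congrArg (coeff · m) (transcendental_iff.mp htr _ hgx)
      rwa [coeff_map, coeff_zero, Ideal.Quotient.algebraMap_eq,
        Ideal.Quotient.eq_zero_iff_mem] at hfm
  exact hp0 (Ideal.mem_bot.mp (hker ▸ hp))

theorem exists_eq_C_mul_of_valuationRing {W ι : Type*} [CommRing W] [IsDomain W] [ValuationRing W]
    {p : MvPolynomial ι W} (hp : p ≠ 0) :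
    ∃ m, ∃ q, p = MvPolynomial.C (p.coeff m) * q ∧ q.coeff m = 1 := by
  obtain ⟨m, hm, hmax⟩ := p.support.exists_maximalFor (fun m => Ideal.span {p.coeff m})
    (MvPolynomial.support_nonempty.mpr hp)
  have hdvd : MvPolynomial.C (p.coeff m) ∣ p := by
    refine (MvPolynomial.C_dvd_iff_dvd_coeff _ _).mpr fun m' => ?_
    by_cases hm' : m' ∈ p.support
    · rw [← Ideal.span_singleton_le_span_singleton]
      rcases total_of (· ≤ ·) (Ideal.span {p.coeff m'}) (Ideal.span {p.coeff m}) with h | h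
      · exact h
      · exact hmax hm' h
    · rw [MvPolynomial.notMem_support_iff.mp hm']
      exact dvd_zero _
  obtain ⟨q, hq⟩ := hdvd
  refine ⟨m, q, hq, ?_⟩
  have hcoeff := congrArg (MvPolynomial.coeff m) hq
  rw [MvPolynomial.coeff_C_mul] at hcoeff
  exact (mul_eq_left₀ (MvPolynomial.mem_support_iff.mp hm)).mp hcoeff.symm

theorem eq_zero_of_isAlgebraic_coeff {K L ι : Type*} [CommRing K] [IsDomain K] [CommRing L]
    [IsDomain L] [Algebra K L] {z : ι → L} (hz : AlgebraicIndependent K z) {q : MvPolynomial ι L}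
    (hq : ∀ m, IsAlgebraic K (q.coeff m)) (hqz : MvPolynomial.aeval z q = 0) : q = 0 := by
  let A := Subalgebra.algebraicClosure K L
  obtain ⟨r, rfl⟩ : q ∈ Set.range (MvPolynomial.map (algebraMap A L)) := by
    refine MvPolynomial.mem_range_map_iff_coeffs_subset.mpr fun a ha => ?_
    obtain ⟨m, -, rfl⟩ := MvPolynomial.mem_coeffs_iff.mp ha
    exact ⟨⟨_, hq m⟩, rfl⟩
  rw [MvPolynomial.aeval_map_algebraMap] at hqz
  rw [(hz.extendScalars A).eq_zero_of_aeval_eq_zero r hqz, map_zero]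

theorem NoUppersBelow.algebraicIndependent_of_valuationRing {R W T ι : Type*} [CommRing R]
    [CommRing W] [IsDomain W] [ValuationRing W] [CommRing T] [IsDomain T] [Algebra R W]
    [FaithfulSMul R W] [Algebra R T] {P : Ideal R} [Algebra (R ⧸ P) T]
    [IsScalarTower R (R ⧸ P) T] (hP : NoUppersBelow P) (g : W →ₐ[R] T) {z : ι → W}
    (hz : AlgebraicIndependent (R ⧸ P) (g ∘ z)) : AlgebraicIndependent R z := by
  have hinj := FaithfulSMul.algebraMap_injective R W
  have : IsDomain R := hinj.isDomain _
  have : IsDomain (R ⧸ P) := hz.algebraMap_injective.isDomain _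
  rw [algebraicIndependent_iff]
  intro p hp
  by_contra hp0
  have hpW : p.map (algebraMap R W) ≠ 0 := by
    rwa [← map_zero (MvPolynomial.map (algebraMap R W)),
      (MvPolynomial.map_injective _ hinj).ne_iff]
  obtain ⟨m, q, hpq, hqm⟩ := exists_eq_C_mul_of_valuationRing hpW
  rw [MvPolynomial.coeff_map] at hpq
  have hc : algebraMap R W (p.coeff m) ≠ 0 := fun h => hpW (by rw [hpq, h, map_zero, zero_mul])
  have hcoeff (m' : ι →₀ ℕ) : IsAlgebraic R (q.coeff m') := by
    refine .of_mul (mem_nonZeroDivisors_of_ne_zero hc) (isAlgebraic_algebraMap _) ?_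
    rw [← MvPolynomial.coeff_C_mul, ← hpq, MvPolynomial.coeff_map]
    exact isAlgebraic_algebraMap _
  have hqz : MvPolynomial.aeval z q = 0 := by
    rw [← MvPolynomial.aeval_map_algebraMap W, hpq, map_mul, MvPolynomial.aeval_C] at hp
    exact (mul_eq_zero.mp hp).resolve_left hc
  have hq0 : q.map (g : W →+* T) = 0 := by
    refine eq_zero_of_isAlgebraic_coeff hz (fun m' => ?_) ?_
    · rw [MvPolynomial.coeff_map]
      exact hP.isAlgebraic_apply g (hcoeff m')
    · rw [MvPolynomial.aeval_def, MvPolynomial.eval₂_map, ← map_zero g, ← hqz]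
      exact (MvPolynomial.hom_eval₂ q (algebraMap W W) (g : W →+* T) z).symm
  have hm := congrArg (MvPolynomial.coeff m) hq0
  rw [MvPolynomial.coeff_map, hqm, map_one, MvPolynomial.coeff_zero] at hm
  exact one_ne_zero hm

theorem exists_valuationRing_isLocalHom (R : Type u) [CommRing R] [IsDomain R] [IsLocalRing R] :
    ∃ (W : Type u) (_ : CommRing W) (_ : IsDomain W) (_ : ValuationRing W) (_ : Algebra R W),
      FaithfulSMul R W ∧ IsLocalHom (algebraMap R W) := by
  obtain ⟨W, h, hloc⟩ := IsLocalRing.exists_factor_valuationRing (algebraMap R (FractionRing R))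
  let _ : Algebra R W :=
    ((algebraMap R (FractionRing R)).codRestrict W.toSubring h).toAlgebra
  refine ⟨W, inferInstance, inferInstance, inferInstance, inferInstance, ?_, hloc⟩
  refine (faithfulSMul_iff_algebraMap_injective R W).mpr (.of_comp (f := W.subtype) ?_)
  exact IsFractionRing.injective R (FractionRing R)

theorem exists_valuationRing_liesOver {R : Type u} [CommRing R] [IsDomain R] (P : Ideal R)
    [P.IsPrime] :
    ∃ (W : Type u) (_ : CommRing W) (_ : IsDomain W) (_ : ValuationRing W) (_ : Algebra R W)
      (Q : Ideal W), FaithfulSMul R W ∧ Q.IsPrime ∧ Q.LiesOver P := by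
  let S := Localization.AtPrime P
  have : IsDomain S := IsLocalization.isDomain_localization P.primeCompl_le_nonZeroDivisors
  have : FaithfulSMul R S := (faithfulSMul_iff_algebraMap_injective R S).mpr
    (IsLocalization.injective S P.primeCompl_le_nonZeroDivisors)
  obtain ⟨W, _, _, _, _, _, _⟩ := exists_valuationRing_isLocalHom S
  let _ : Algebra R W := Algebra.compHom W (algebraMap R S)
  have : IsScalarTower R S W := .of_algebraMap_eq' rfl
  refine ⟨W, inferInstance, inferInstance, inferInstance, inferInstance,
    IsLocalRing.maximalIdeal W, .trans R S W, inferInstance, ⟨?_⟩⟩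
  rw [← Ideal.under_under (B := S), Ideal.under, Ideal.under, IsLocalRing.maximalIdeal_comap]
  exact (IsLocalization.AtPrime.under_maximalIdeal S P).symm

theorem NoUppersBelow.algebraicIndependent {R : Type*} {S : Type u} {T ι : Type*} [CommRing R]
    [CommRing S] [IsDomain S] [CommRing T] [IsDomain T] [Algebra R S] [FaithfulSMul R S]
    [Algebra R T] {P : Ideal R} [Algebra (R ⧸ P) T] [IsScalarTower R (R ⧸ P) T]
    (hP : NoUppersBelow P) (g : S →ₐ[R] T) {z : ι → S}
    (hz : AlgebraicIndependent (R ⧸ P) (g ∘ z)) : AlgebraicIndependent R z := by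
  have : (RingHom.ker g).IsPrime := RingHom.ker_isPrime g
  obtain ⟨W, _, _, _, _, Q, _, _, _⟩ := exists_valuationRing_liesOver (RingHom.ker g)
  let _ : Algebra R W := Algebra.compHom W (algebraMap R S)
  have : IsScalarTower R S W := .of_algebraMap_eq' rfl
  have : FaithfulSMul R W := .trans R S W
  have hPker : P = (RingHom.ker g).under R := by
    ext a
    rw [Ideal.mem_comap, RingHom.mem_ker, g.commutes, IsScalarTower.algebraMap_apply R (R ⧸ P) T,
      map_eq_zero_iff _ hz.algebraMap_injective]
    exact Ideal.Quotient.eq_zero_iff_mem.symm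
  have : (RingHom.ker g).LiesOver P := ⟨hPker⟩
  have : Q.LiesOver P := .trans Q (RingHom.ker g) P
  refine .of_comp (IsScalarTower.toAlgHom R S W) <|
    hP.algebraicIndependent_of_valuationRing (Ideal.Quotient.mkₐ R Q) <|
      (algebraicIndependent_quotient_iff P _).mpr fun f hf =>
        (algebraicIndependent_quotient_iff P _).mp hz f ?_
  have hfQ : algebraMap S W (MvPolynomial.aeval z f) ∈ Q := by
    rw [← Ideal.Quotient.eq_zero_iff_mem, ← hf]
    exact MvPolynomial.comp_aeval_apply z
      ((Ideal.Quotient.mkₐ R Q).comp (IsScalarTower.toAlgHom R S W)) f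
  rw [← Ideal.mem_comap, ← Ideal.under_def, ← Q.over_def (RingHom.ker g)] at hfQ
  exact (MvPolynomial.comp_aeval_apply z g f).symm.trans hfQ

theorem NoUppersBelow.trdeg_quotient_le {R : Type*} {S T : Type u} [CommRing R] [CommRing S]
    [IsDomain S] [CommRing T] [IsDomain T] [Algebra R S] [FaithfulSMul R S]
    [Algebra R T] {P : Ideal R} [Algebra (R ⧸ P) T] [IsScalarTower R (R ⧸ P) T]
    [FaithfulSMul (R ⧸ P) T] (hP : NoUppersBelow P) (g : S →ₐ[R] T) (hg : Function.Surjective g) :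
    Algebra.trdeg (R ⧸ P) T ≤ Algebra.trdeg R S := by
  have : Nontrivial R := (algebraMap R S).domain_nontrivial
  have : Nontrivial (R ⧸ P) := (algebraMap (R ⧸ P) T).domain_nontrivial
  obtain ⟨ι, x, hx⟩ := exists_isTranscendenceBasis' (R ⧸ P) T
  choose y hy using fun i => hg (x i)
  rw [← hx.cardinalMk_eq_trdeg]
  refine (hP.algebraicIndependent g (z := y) ?_).cardinalMk_le_trdeg
  rw [show g ∘ y = x from funext hy]
  exact hx.1

theorem quasiFiniteAt_of_isMin_of_isMax {R S : Type*} [CommRing R] [CommRing S] [Algebra R S]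
    [Algebra.FiniteType R S] {P : PrimeSpectrum R}
    {Q : PrimeSpectrum.comap (algebraMap R S) ⁻¹' {P}} (hmin : IsMin Q) (hmax : IsMax Q) :
    Algebra.QuasiFiniteAt R Q.1.asIdeal := by
  obtain ⟨Q, rfl⟩ := Q
  refine Algebra.QuasiFiniteAt.of_isOpen_singleton_fiber Q ?_
  let P := Q.comap (algebraMap R S)
  let e := PrimeSpectrum.preimageOrderIsoFiber R S P
  have : IsNoetherianRing (P.asIdeal.Fiber S) :=
    Algebra.FiniteType.isNoetherianRing P.asIdeal.ResidueField _
  have : IsJacobsonRing (P.asIdeal.Fiber S) :=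
    isJacobsonRing_of_finiteType (A := P.asIdeal.ResidueField)
  rw [← (PrimeSpectrum.preimageHomeomorphFiber R S P).isOpen_image, Set.image_singleton,
    (PrimeSpectrum.isOpen_singleton_tfae_of_isNoetherian_of_isJacobsonRing _).out 0 2 rfl rfl,
    PrimeSpectrum.isClosed_singleton_iff_isMaximal, ← PrimeSpectrum.isMax_iff,
    PrimeSpectrum.stableUnderGeneralization_singleton, ← PrimeSpectrum.isMin_iff]
  exact ⟨e.isMax_apply.mpr hmax, e.isMin_apply.mpr hmin⟩

theorem isAlgebraic_of_quasiFiniteAt {A B : Type*} [CommRing A] [CommRing B] [IsDomain B]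
    [Algebra A B] [FaithfulSMul A B] (Q : Ideal B) [Q.IsPrime] [Algebra.QuasiFiniteAt A Q] :
    Algebra.IsAlgebraic A B := by
  have : IsDomain A := (FaithfulSMul.algebraMap_injective A B).isDomain _
  have hbot : Algebra.QuasiFiniteAt A (⊥ : Ideal B) := .of_le (bot_le (a := Q))
  have : IsFractionRing B (Localization.AtPrime (⊥ : Ideal B)) := by
    rw [IsFractionRing, ← Ideal.primeCompl_bot]
    infer_instance
  let e := FractionRing.algEquiv B (Localization.AtPrime (⊥ : Ideal B))
  have : Algebra.QuasiFinite A (FractionRing B) :=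
    .of_surjective_algHom (e.symm.toAlgHom.restrictScalars A) e.symm.surjective
  have : FaithfulSMul A (FractionRing B) := .trans A B (FractionRing B)
  let _ : Algebra (FractionRing A) (FractionRing B) := FractionRing.liftAlgebra A (FractionRing B)
  have : Algebra.QuasiFinite (FractionRing A) (FractionRing B) := .of_restrictScalars A _ _
  have : Module.Finite (FractionRing A) (FractionRing B) := .of_quasiFinite
  have : Algebra.IsAlgebraic A (FractionRing B) :=
    (IsFractionRing.comap_isAlgebraic_iff (K := FractionRing A)).mpr inferInstance
  exact .of_injective (IsScalarTower.toAlgHom A B (FractionRing B))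
    (IsFractionRing.injective B (FractionRing B))

theorem isAlgebraic_of_bot_covBy {A B : Type*} [CommRing A] [CommRing B] [IsDomain B]
    [Algebra A B] [FaithfulSMul A B] [Algebra.FiniteType A B] {N : PrimeSpectrum B} (hN : ⊥ ⋖ N)
    (hN0 : N.asIdeal.under A ≠ ⊥)
    [Algebra.IsAlgebraic (A ⧸ N.asIdeal.under A) (B ⧸ N.asIdeal)] : Algebra.IsAlgebraic A B := by
  let Q : PrimeSpectrum.comap (algebraMap A B) ⁻¹' {N.comap (algebraMap A B)} := ⟨N, rfl⟩
  have hmin : IsMin Q := by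
    rintro ⟨Q', hQ'⟩ hle
    rcases hN.eq_or_eq bot_le hle with rfl | h
    · refine absurd ?_ hN0
      rw [← Ideal.comap_bot_of_injective _ (FaithfulSMul.algebraMap_injective A B)]
      exact congrArg PrimeSpectrum.asIdeal hQ'.symm
    · exact h.ge
  have hmax : IsMax Q := by
    rintro ⟨Q', hQ'⟩ hle b hb
    by_contra hbN
    have hbN' : Ideal.Quotient.mk N.asIdeal b ≠ 0 := mt Ideal.Quotient.eq_zero_iff_mem.mp hbN
    refine Ideal.comap_ne_bot_of_algebraic_mem hbN' (Ideal.mem_map_of_mem _ hb)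
      (Algebra.IsAlgebraic.isAlgebraic (R := A ⧸ N.asIdeal.under A) _) ?_
    refine le_bot_iff.mp fun a ha => ?_
    obtain ⟨a, rfl⟩ := Ideal.Quotient.mk_surjective a
    have haQ' : algebraMap A B a ∈ Q'.asIdeal :=
      (Ideal.mem_quotient_iff_mem (J := Q'.asIdeal) hle).mp ha
    refine Ideal.Quotient.eq_zero_iff_mem.mpr ?_
    exact (congrArg PrimeSpectrum.asIdeal hQ').le haQ'
  have : Algebra.QuasiFiniteAt A N.asIdeal := quasiFiniteAt_of_isMin_of_isMax hmin hmax
  exact isAlgebraic_of_quasiFiniteAt N.asIdeal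

theorem toSubring_adjoin_image_quotient_mk {R S : Type*} [CommRing R] [CommRing S] [Algebra R S]
    (Q : Ideal S) (s : Set S) :
    (Algebra.adjoin (R ⧸ Q.under R) (Ideal.Quotient.mk Q '' s)).toSubring =
      (Algebra.adjoin R s).toSubring.map (Ideal.Quotient.mk Q) := by
  simp only [Algebra.adjoin_eq_ring_closure, RingHom.map_closure, Set.image_union,
    ← Set.range_comp]
  congr 2
  exact (Ideal.Quotient.mk_surjective (I := Q.under R)).range_comp
    (algebraMap (R ⧸ Q.under R) (S ⧸ Q)) |>.symm

theorem isAlgebraic_quotient_adjoin {R S : Type*} [CommRing R] [CommRing S] [Algebra R S]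
    (Q : Ideal S) (s : Set S)
    [Algebra.IsAlgebraic (Algebra.adjoin (R ⧸ Q.under R) (Ideal.Quotient.mk Q '' s)) (S ⧸ Q)] :
    Algebra.IsAlgebraic (Algebra.adjoin R s ⧸ Q.under (Algebra.adjoin R s)) (S ⧸ Q) := by
  have hmem (z : S ⧸ Q) : z ∈ Algebra.adjoin (R ⧸ Q.under R) (Ideal.Quotient.mk Q '' s) ↔
      ∃ b ∈ Algebra.adjoin R s, Ideal.Quotient.mk Q b = z :=
    (SetLike.ext_iff.mp (toSubring_adjoin_image_quotient_mk Q s) z).trans Subring.mem_map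
  refine .of_ringHom_of_comp_eq
    ((algebraMap (Algebra.adjoin R s ⧸ Q.under (Algebra.adjoin R s)) (S ⧸ Q)).codRestrict
      (Algebra.adjoin (R ⧸ Q.under R) (Ideal.Quotient.mk Q '' s)) fun a => ?_)
    (RingHom.id _) ?_ Function.injective_id rfl
  · obtain ⟨a, rfl⟩ := Ideal.Quotient.mk_surjective a
    exact (hmem _).mpr ⟨a, a.2, rfl⟩
  · rintro ⟨z, hz⟩
    obtain ⟨b, hb, rfl⟩ := (hmem z).mp hz
    exact ⟨Ideal.Quotient.mk _ ⟨b, hb⟩, rfl⟩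

theorem isAlgebraic_quotient_polynomial {R : Type*} [CommRing R] [IsDomain R] {q : Ideal R[X]}
    (hq : q ≠ ⊥) : Algebra.IsAlgebraic R (R[X] ⧸ q) := by
  have haeval (p : R[X]) : aeval (Ideal.Quotient.mk q X) p = Ideal.Quotient.mk q p := by
    rw [← Ideal.Quotient.mkₐ_eq_mk R q, aeval_algHom_apply, aeval_X_left_apply]
  obtain ⟨p, hp, hp0⟩ := q.ne_bot_iff.mp hq
  have hroot : IsAlgebraic R (Ideal.Quotient.mk q X) :=
    ⟨p, hp0, (haeval p).trans (Ideal.Quotient.eq_zero_iff_mem.mpr hp)⟩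
  refine ⟨fun z => ?_⟩
  obtain ⟨f, rfl⟩ := Ideal.Quotient.mk_surjective z
  rw [← haeval]
  exact Algebra.isAlgebraic_adjoin_singleton_iff.mpr hroot _ (aeval_mem_adjoin_singleton R _)

theorem trdeg_le_trdeg_quotient {D : Type*} {B : Type u} [CommRing D] [CommRing B] [IsDomain B]
    [Algebra D B] [FaithfulSMul D B] [Algebra.FiniteType D B] {N : PrimeSpectrum B} (hN : ⊥ ⋖ N)
    (hN0 : N.asIdeal.under D ≠ ⊥) :
    Algebra.trdeg D B ≤ Algebra.trdeg (D ⧸ N.asIdeal.under D) (B ⧸ N.asIdeal) := by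
  obtain ⟨ι, x, hx⟩ := exists_isTranscendenceBasis' (D ⧸ N.asIdeal.under D) (B ⧸ N.asIdeal)
  choose y hy using fun i => Ideal.Quotient.mk_surjective (x i)
  let A := Algebra.adjoin D (Set.range y)
  have : Algebra.IsAlgebraic A B := by
    have : Algebra.FiniteType A B := .of_restrictScalars_finiteType D A B
    have : Algebra.IsAlgebraic (A ⧸ N.asIdeal.under A) (B ⧸ N.asIdeal) := by
      have hxy : Ideal.Quotient.mk N.asIdeal '' Set.range y = Set.range x := by
        rw [← Set.range_comp, ← funext hy]
        rfl
      have := hx.isAlgebraic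
      rw [← hxy] at this
      exact isAlgebraic_quotient_adjoin N.asIdeal (Set.range y)
    have : FaithfulSMul D A := .tower_bot D A B
    refine isAlgebraic_of_bot_covBy hN fun h => hN0 ?_
    rw [← Ideal.under_under (B := A), h]
    exact Ideal.comap_bot_of_injective _ (FaithfulSMul.algebraMap_injective D A)
  rw [← hx.cardinalMk_eq_trdeg]
  exact (Algebra.IsAlgebraic.trdeg_le_cardinalMk D (Set.range y)).trans Cardinal.mk_range_le

theorem NoUppersBelow.of_finiteType {D : Type*} {B : Type u} [CommRing D] [CommRing B] [IsDomain B]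
    [Algebra D B] [FaithfulSMul D B] [Algebra.FiniteType D B] {N : PrimeSpectrum B} (hN : ⊥ ⋖ N)
    (hN0 : N.asIdeal.under D ≠ ⊥) (hD : NoUppersBelow (N.asIdeal.under D)) :
    NoUppersBelow N.asIdeal := by
  intro q hq hqB hqN
  by_contra hq0
  let D' := D ⧸ N.asIdeal.under D
  let B' := B ⧸ N.asIdeal
  let E := B[X] ⧸ q
  have : FaithfulSMul B E := by
    refine (faithfulSMul_iff_algebraMap_injective B E).mpr ((injective_iff_map_eq_zero _).mpr ?_)
    exact fun b hb => hqB.le ((Ideal.Quotient.eq_zero_iff_mem (I := q)).mp hb)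
  have : FaithfulSMul D E := .trans D B E
  have : Nontrivial D := (algebraMap D B).domain_nontrivial
  have : Algebra.IsAlgebraic B E := isAlgebraic_quotient_polynomial hq0
  let g : E →ₐ[D] B'[X] := Ideal.Quotient.liftₐ q (mapAlgHom (Ideal.Quotient.mkₐ D N.asIdeal))
    fun f hf => by
      ext m
      exact (coeff_map _ m).trans
        (Ideal.Quotient.eq_zero_iff_mem.mpr (Ideal.mem_map_C_iff.mp (hqN hf) m))
  have hg : Function.Surjective g := Ideal.Quotient.lift_surjective_of_surjective _ _ <|
    map_surjective _ Ideal.Quotient.mk_surjective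
  have hlt : Algebra.trdeg D' B' < Algebra.trdeg D' B'[X] := by
    rw [← trdeg_add_eq D' B' (A := B'[X]), Polynomial.trdeg_of_isDomain]
    have : Algebra.FiniteType D' B' := .of_restrictScalars_finiteType D D' B'
    have hfin : Algebra.trdeg D' B' < Cardinal.aleph0 := trdeg_lt_aleph0_of_finiteType
    simpa only [add_zero] using (Cardinal.add_lt_add_iff_of_left_lt_aleph0 hfin).mpr zero_lt_one
  refine hlt.not_ge ?_
  calc Algebra.trdeg D' B'[X] ≤ Algebra.trdeg D E := hD.trdeg_quotient_le g hg
    _ = Algebra.trdeg D B := by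
      rw [← trdeg_add_eq D B (A := E), trdeg_eq_zero (R := B), add_zero]
    _ ≤ Algebra.trdeg D' B' := trdeg_le_trdeg_quotient hN hN0

/-- Every prime of `R[X]` contained in `P[X]` is extended from `R`: the condition that the
`⋆`-quasi-Prüfer property imposes on each quasi-`⋆`-prime. -/
def IsQuasiPruferPrime {R : Type*} [CommRing R] (P : PrimeSpectrum R) : Prop :=
  ∀ Q ≤ polynomialExtension P, Q = polynomialExtension (Q.comap C)

theorem IsQuasiPruferPrime.noUppersBelow {R S : Type*} [CommRing R] [CommRing S] {f : R →+* S}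
    (hf : Function.Surjective f) {P : PrimeSpectrum S} (hP : IsQuasiPruferPrime (P.comap f)) :
    NoUppersBelow P.asIdeal := by
  intro Q hQ hQ0 hQP
  let Q' : PrimeSpectrum S[X] := ⟨Q, hQ⟩
  have hle : Q'.comap (mapRingHom f) ≤ polynomialExtension (P.comap f) := by
    rw [polynomialExtension_comap]
    exact Ideal.comap_mono hQP
  have hcomap : (Q'.comap (mapRingHom f)).comap C = (Q'.comap C).comap f := by
    rw [← PrimeSpectrum.comap_comp_apply, ← PrimeSpectrum.comap_comp_apply, mapRingHom_comp_C]
  have hext : Q' = polynomialExtension (Q'.comap C) := by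
    refine PrimeSpectrum.comap_injective_of_surjective (mapRingHom f) (map_surjective f hf) ?_
    rw [← polynomialExtension_comap, ← hcomap]
    exact hP _ hle
  calc Q = (Q.comap C).map C := congrArg PrimeSpectrum.asIdeal hext
    _ = ⊥ := by rw [hQ0, Ideal.map_bot]

theorem IsQuasiPruferPrime.isUniversallyStrongSPrime {D : Type u} [CommRing D]
    {P : PrimeSpectrum D} (hP : IsQuasiPruferPrime P) : IsUniversallyStrongSPrime P := by
  refine isUniversallyStrongSPrime_of_bot_covBy fun B _ _ _ _ N hNP hN => ?_
  let D₁ : Subalgebra D B := ⊥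
  have : Algebra.FiniteType D₁ B := .of_restrictScalars_finiteType D D₁ B
  by_cases hN0 : N.asIdeal.under D₁ = ⊥
  · have : N.asIdeal.LiesOver (⊥ : Ideal D₁) := ⟨hN0.symm⟩
    have := isNoetherianRing_localization_bot D₁
    have := isNoetherianRing_localization_of_finiteType (⊥ : Ideal D₁) N.asIdeal
    exact bot_covBy_polynomialExtension_of_isNoetherianRing hN
  · have hsurj : Function.Surjective (algebraMap D D₁) := by
      rintro ⟨_, b, rfl⟩
      exact ⟨b, rfl⟩
    have hD₁ : NoUppersBelow (N.comap (algebraMap D₁ B)).asIdeal := by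
      refine IsQuasiPruferPrime.noUppersBelow hsurj ?_
      rwa [← PrimeSpectrum.comap_comp_apply, ← IsScalarTower.algebraMap_eq, hNP]
    exact (NoUppersBelow.of_finiteType hN hN0 hD₁).bot_covBy_polynomialExtension hN

end QuasiPrufer

section ContentIdeal

theorem contentIdeal_le_iff_mem_map_C {R : Type*} [CommRing R] {s : R[X]} {I : Ideal R} :
    s.contentIdeal ≤ I ↔ s ∈ I.map C := by
  rw [Ideal.mem_map_C_iff]
  refine ⟨fun h i => h (s.coeff_mem_contentIdeal i), fun h => ?_⟩
  rw [contentIdeal_def, Ideal.span_le]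
  intro a ha
  obtain ⟨i, -, rfl⟩ := mem_coeffs_iff.mp ha
  exact h i

theorem exists_contentIdeal_eq {R : Type*} [CommRing R] {I : Ideal R} (hI : I.FG) :
    ∃ s : R[X], s.contentIdeal = I := by
  classical
  obtain ⟨n, g, rfl⟩ := Submodule.fg_iff_exists_fin_generating_family.mp hI
  refine ⟨ofFn n g, le_antisymm ?_ (Submodule.span_le.mpr ?_)⟩
  · refine contentIdeal_le_iff_mem_map_C.mpr (Ideal.mem_map_C_iff.mpr fun i => ?_)
    rcases lt_or_ge i n with hi | hi
    · rw [ofFn_coeff_eq_val_of_lt g hi]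
      exact Submodule.subset_span ⟨_, rfl⟩
    · rw [ofFn_coeff_eq_zero_of_ge g hi]
      exact Submodule.zero_mem _
  · rintro _ ⟨i, rfl⟩
    exact ofFn_coeff_eq_val_of_lt g i.2 ▸ coeff_mem_contentIdeal (ofFn n g) i

end ContentIdeal

namespace SemistarOperation

section ProperPrimes

variable {A : Type u} {L : Type v} [CommRing A] [Field L] [Algebra A L]

theorem IsQuasiIdeal.algebraMap_mem_iff {star : SemistarOperation A L} {I : Ideal A}
    (hI : star.IsQuasiIdeal I) {x : A} :
    algebraMap A L x ∈ star (IsLocalization.coeSubmodule L I) ↔ x ∈ I :=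
  SetLike.ext_iff.mp hI.2 x

theorem IsQuasiIdeal.one_mem_iff {star : SemistarOperation A L} {I : Ideal A}
    (hI : star.IsQuasiIdeal I) : 1 ∈ star (IsLocalization.coeSubmodule L I) ↔ I = ⊤ := by
  rw [← map_one (algebraMap A L), hI.algebraMap_mem_iff, Ideal.eq_top_iff_one]

variable [IsFractionRing A L]

theorem algebraMap_mem_coeSubmodule {I : Ideal A} {x : A} :
    algebraMap A L x ∈ IsLocalization.coeSubmodule L I ↔ x ∈ I := by
  rw [IsLocalization.mem_coeSubmodule]
  refine ⟨?_, fun h => ⟨x, h, rfl⟩⟩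
  rintro ⟨y, hy, h⟩
  rwa [← IsFractionRing.injective A L h]

theorem coeSubmodule_ne_bot {I : Ideal A} (hI : I ≠ ⊥) :
    IsLocalization.coeSubmodule L I ≠ ⊥ := fun h =>
  hI (IsFractionRing.coeSubmodule_injective A L (h.trans (IsLocalization.coeSubmodule_bot L).symm))

variable (star : SemistarOperation A L)

theorem le_comap_star {I : Ideal A} (hI : I ≠ ⊥) :
    I ≤ (star (IsLocalization.coeSubmodule L I)).comap (Algebra.linearMap A L) := fun _ hx =>
  star.le_self _ (coeSubmodule_ne_bot hI) (algebraMap_mem_coeSubmodule.mpr hx)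

theorem isQuasiIdeal_of_le {I : Ideal A} (hI : I ≠ ⊥)
    (h : ∀ x, algebraMap A L x ∈ star (IsLocalization.coeSubmodule L I) → x ∈ I) :
    star.IsQuasiIdeal I :=
  ⟨hI, le_antisymm h (star.le_comap_star hI)⟩

theorem isQuasiIdeal_comap {I : Ideal A} (hI : I ≠ ⊥) :
    star.IsQuasiIdeal
      ((star (IsLocalization.coeSubmodule L I)).comap (Algebra.linearMap A L)) := by
  have hne := ne_bot_of_le_ne_bot hI (star.le_comap_star hI)
  refine star.isQuasiIdeal_of_le hne fun x hx => ?_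
  change algebraMap A L x ∈ star _
  rw [← star.idem _ (coeSubmodule_ne_bot hI)]
  exact star.mono _ _ (coeSubmodule_ne_bot hne) (Submodule.map_comap_le _ _) hx

theorem isQuasiMaximal_of_maximal {I M : Ideal A} (hI : I ≠ ⊥)
    (hM : Maximal (fun J => I ≤ J ∧ 1 ∉ star (IsLocalization.coeSubmodule L J)) M) :
    star.IsQuasiMaximal M := by
  have hM0 : M ≠ ⊥ := ne_bot_of_le_ne_bot hI hM.prop.1
  have hquasi : star.IsQuasiIdeal M := by
    have hclosure := star.isQuasiIdeal_comap hM0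
    have hMJ := star.le_comap_star hM0
    set J := (star (IsLocalization.coeSubmodule L M)).comap (Algebra.linearMap A L)
    have h1 : 1 ∉ star (IsLocalization.coeSubmodule L J) := by
      rw [hclosure.one_mem_iff, Ideal.eq_top_iff_one]
      exact fun h => hM.prop.2 (map_one (algebraMap A L) ▸ h)
    rwa [← hM.eq_of_le ⟨hM.prop.1.trans hMJ, h1⟩ hMJ] at hclosure
  refine ⟨⟨fun h => hM.prop.2 (hquasi.one_mem_iff.mpr h), hquasi⟩, fun J hJ hMJ => ?_⟩
  exact hM.le_of_ge ⟨hM.prop.1.trans hMJ, mt hJ.2.one_mem_iff.mp hJ.1⟩ hMJ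

theorem one_mem_finiteType_iff {I : Ideal A} (hI : I ≠ ⊥) :
    1 ∈ star.finiteType (IsLocalization.coeSubmodule L I) ↔
      ∃ J : Ideal A, J.FG ∧ J ≠ ⊥ ∧ J ≤ I ∧ 1 ∈ star (IsLocalization.coeSubmodule L J) := by
  rw [mem_finiteType star (coeSubmodule_ne_bot hI)]
  constructor
  · rintro ⟨F, hF, hF0, hFI, h1⟩
    obtain ⟨J, rfl⟩ : ∃ J : Ideal A, IsLocalization.coeSubmodule L J = F :=
      ⟨_, Submodule.map_comap_eq_self (hFI.trans LinearMap.map_le_range)⟩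
    refine ⟨J, ?_, ?_, IsFractionRing.coeSubmodule_le_coeSubmodule.mp hFI, h1⟩
    · exact (IsLocalization.coeSubmodule_fg L (IsFractionRing.injective A L) J).mp hF
    · rintro rfl
      exact hF0 (IsLocalization.coeSubmodule_bot L)
  · rintro ⟨J, hJ, hJ0, hJI, h1⟩
    exact ⟨_, Submodule.FG.map (Algebra.linearMap A L) hJ, coeSubmodule_ne_bot hJ0,
      IsLocalization.coeSubmodule_mono L hJI, h1⟩

theorem exists_le_isQuasiMaximal_finiteType {I : Ideal A}
    (hI : I ≠ ⊥) (h1 : 1 ∉ star.finiteType (IsLocalization.coeSubmodule L I)) :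
    ∃ M, star.finiteType.IsQuasiMaximal M ∧ I ≤ M := by
  let T : Set (Ideal A) := {J | I ≤ J ∧ 1 ∉ star.finiteType (IsLocalization.coeSubmodule L J)}
  have sSup_mem (c : Set (Ideal A)) (hcT : c ⊆ T) (hc : IsChain (· ≤ ·) c) (N : Ideal A)
      (hN : N ∈ c) : sSup c ∈ T := by
    have hIc : I ≤ sSup c := (hcT hN).1.trans (le_sSup hN)
    refine ⟨hIc, fun h => ?_⟩
    obtain ⟨J, hJ, hJ0, hJc, h2⟩ :=
      (one_mem_finiteType_iff star (ne_bot_of_le_ne_bot hI hIc)).mp h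
    obtain ⟨N', hN', hJN'⟩ :=
      (CompleteLattice.isCompactElement_iff_le_of_directed_sSup_le _ J).mp
        ((Submodule.fg_iff_compact J).mp hJ) c ⟨N, hN⟩ hc.directedOn hJc
    exact (hcT hN').2 ((one_mem_finiteType_iff star (ne_bot_of_le_ne_bot hI (hcT hN').1)).mpr
      ⟨J, hJ, hJ0, hJN', h2⟩)
  obtain ⟨M, hIM, hM⟩ := zorn_le_nonempty₀ T
    (fun c hcT hc N hN => ⟨sSup c, sSup_mem c hcT hc N hN, fun _ => le_sSup⟩) I ⟨le_rfl, h1⟩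
  exact ⟨M, star.finiteType.isQuasiMaximal_of_maximal hI hM, hIM⟩

theorem star_top_le_of_one_mem {I : Ideal A} (hI : I ≠ ⊥)
    (h1 : 1 ∈ star (IsLocalization.coeSubmodule L I)) :
    star (IsLocalization.coeSubmodule L ⊤) ≤ star (IsLocalization.coeSubmodule L I) := by
  rw [← star.idem _ (coeSubmodule_ne_bot hI)]
  refine star.mono _ _ (ne_bot_of_le (coeSubmodule_ne_bot hI)
    (IsLocalization.coeSubmodule_mono L le_top)) ?_
  rintro _ ⟨a, -, rfl⟩
  simpa [Algebra.smul_def] using (star (IsLocalization.coeSubmodule L I)).smul_mem a h1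

theorem finiteType_lt_iff {I : Ideal A} (hI : I ≠ ⊥) :
    star.finiteType (IsLocalization.coeSubmodule L I) < star (IsLocalization.coeSubmodule L ⊤) ↔
      1 ∉ star.finiteType (IsLocalization.coeSubmodule L I) := by
  have hle : star.finiteType (IsLocalization.coeSubmodule L I) ≤
      star (IsLocalization.coeSubmodule L ⊤) := by
    intro x hx
    obtain ⟨F, -, hF0, hFI, hx⟩ := (mem_finiteType star (coeSubmodule_ne_bot hI)).mp hx
    exact star.mono _ _ hF0 (hFI.trans (IsLocalization.coeSubmodule_mono L le_top)) hx
  have htop : (⊤ : Ideal A) ≠ ⊥ := fun h => hI (le_bot_iff.mp (h ▸ le_top))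
  rw [lt_iff_le_not_ge, and_iff_right hle]
  have hone : (1 : L) ∈ IsLocalization.coeSubmodule L (⊤ : Ideal A) :=
    ⟨1, Submodule.mem_top, map_one (algebraMap A L)⟩
  refine not_congr ⟨fun h => h (star.le_self _ (coeSubmodule_ne_bot htop) hone), fun h x hx => ?_⟩
  obtain ⟨J, hJ, hJ0, hJI, h1⟩ := (one_mem_finiteType_iff star hI).mp h
  exact (mem_finiteType star (coeSubmodule_ne_bot hI)).mpr
    ⟨_, Submodule.FG.map (Algebra.linearMap A L) hJ, coeSubmodule_ne_bot hJ0,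
      IsLocalization.coeSubmodule_mono L hJI, star_top_le_of_one_mem star hJ0 h1 hx⟩

/-- The primes `P` of `A` with `P = 0` or `P^{⋆_f} ⊊ A^⋆`. The set `Θ` in the definition of `⋆[X]`
consists of the primes of `A[X]` lying over them. -/
def properPrimes : Set (PrimeSpectrum A) :=
  {P | P.asIdeal = ⊥ ∨ star.finiteType (IsLocalization.coeSubmodule L P.asIdeal) <
    star (IsLocalization.coeSubmodule L ⊤)}

theorem mem_properPrimes_iff {P : PrimeSpectrum A} :
    P ∈ star.properPrimes ↔
      ∀ J : Ideal A, J.FG → J ≠ ⊥ → J ≤ P.asIdeal →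
        1 ∉ star (IsLocalization.coeSubmodule L J) := by
  by_cases h0 : P.asIdeal = ⊥
  · exact iff_of_true (Or.inl h0) fun J _ hJ0 hJP => absurd (le_bot_iff.mp (hJP.trans h0.le)) hJ0
  · refine (or_iff_right h0).trans ?_
    rw [finiteType_lt_iff star h0, one_mem_finiteType_iff star h0]
    push Not
    rfl

theorem isLowerSet_properPrimes : IsLowerSet star.properPrimes := fun _ _ hQP hP =>
  star.mem_properPrimes_iff.mpr fun J hJ hJ0 hJQ =>
    star.mem_properPrimes_iff.mp hP J hJ hJ0 (hJQ.trans hQP)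

theorem mem_properPrimes_of_isQuasiPrime {P : PrimeSpectrum A}
    (hP : star.IsQuasiPrime P.asIdeal) : P ∈ star.properPrimes :=
  star.mem_properPrimes_iff.mpr fun _ _ hJ0 hJP h1 => hP.1.ne_top <| hP.2.one_mem_iff.mp <|
    star.mono _ _ (coeSubmodule_ne_bot hJ0) (IsLocalization.coeSubmodule_mono L hJP) h1

end ProperPrimes

section Adjacent

/-- Every nonzero prime `P` with `P^{⋆_f} ⊊ A^⋆` is a quasi-`⋆`-prime. The converse always holds, so
`QSpec^⋆(A) ∪ {0}` is then the lower set `properPrimes` of `Spec A`. -/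
def ProperPrimesAreQuasiPrime {A : Type u} {L : Type v} [CommRing A] [Field L] [Algebra A L]
    (star : SemistarOperation A L) : Prop :=
  ∀ P ∈ star.properPrimes, P.asIdeal ≠ ⊥ → star.IsQuasiPrime P.asIdeal

theorem ProperPrimesAreQuasiPrime.isAdjacent_iff {A : Type u} {L : Type v} [CommRing A]
    [Field L] [Algebra A L] [IsFractionRing A L] {star : SemistarOperation A L}
    (hstar : star.ProperPrimesAreQuasiPrime) {P₁ P₂ : PrimeSpectrum A} :
    star.IsAdjacent P₁.asIdeal P₂.asIdeal ↔ P₂ ∈ star.properPrimes ∧ P₁ ⋖ P₂ := by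
  have quasiPrime_of_lt {P Q : PrimeSpectrum A} (hlt : P < Q) (hQ : Q ∈ star.properPrimes) :
      star.IsQuasiPrime Q.asIdeal :=
    hstar Q hQ (bot_le.trans_lt (show P.asIdeal < Q.asIdeal from hlt)).ne'
  constructor
  · intro h
    have hP₂ := star.mem_properPrimes_of_isQuasiPrime h.right
    exact ⟨hP₂, h.lt, fun Q h1 h2 => h.not_between Q.asIdeal
      (quasiPrime_of_lt h1 (star.isLowerSet_properPrimes h2.le hP₂)) h1 h2⟩
  · rintro ⟨hP₂, h12⟩
    exact
      { left := or_iff_not_imp_left.mpr (hstar P₁ (star.isLowerSet_properPrimes h12.le hP₂))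
        right := quasiPrime_of_lt h12.lt hP₂
        lt := h12.lt
        not_between := fun Q hQ h1 h2 => h12.2 (c := ⟨Q, hQ.1⟩) h1 h2 }

end Adjacent

section Polynomial

variable {A : Type u} {L : Type v} [CommRing A] [Field L] [Algebra A L]
  {L₁ : Type u} [Field L₁] [Algebra A[X] L₁] [IsFractionRing A[X] L₁]
  (star : SemistarOperation A L)

theorem one_mem_polynomial_iff {J : Ideal A[X]} (hJ : J.FG) :
    1 ∈ star.polynomial L₁ (IsLocalization.coeSubmodule L₁ J) ↔
      ∀ Q ∈ star.theta, ¬ J ≤ Q.asIdeal := by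
  have coeff_smul_one_mem_iff (s : A[X][X]) :
      (∀ i, s.coeff i • (1 : L₁) ∈ IsLocalization.coeSubmodule L₁ J) ↔ s.contentIdeal ≤ J := by
    simp only [Algebra.smul_def, mul_one, algebraMap_mem_coeSubmodule,
      contentIdeal_le_iff_mem_map_C, Ideal.mem_map_C_iff]
  refine mem_nagata.trans ?_
  simp only [coeff_smul_one_mem_iff]
  constructor
  · rintro ⟨s, hs, hsJ⟩ Q hQ hJQ
    exact hs Q hQ (contentIdeal_le_iff_mem_map_C.mp (hsJ.trans hJQ))
  · intro h
    -- A polynomial of content `J` lies in `Q[Y]` only if `J ⊆ Q`, so it is the denominator needed.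
    obtain ⟨s, rfl⟩ := exists_contentIdeal_eq hJ
    exact ⟨s, fun Q hQ hsQ => h Q hQ (contentIdeal_le_iff_mem_map_C.mpr hsQ), le_rfl⟩

theorem properPrimes_polynomial [IsFractionRing A L] :
    (star.polynomial L₁).properPrimes = PrimeSpectrum.comap C ⁻¹' star.properPrimes := by
  ext Q
  rw [Set.mem_preimage, mem_properPrimes_iff]
  constructor
  · intro h
    refine star.mem_properPrimes_iff.mpr fun F hF hF0 hFQ h1 => ?_
    refine h (F.map C) (Ideal.FG.map hF C) ?_ (Ideal.map_le_iff_le_comap.mpr hFQ)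
      ((one_mem_polynomial_iff star (Ideal.FG.map hF C)).mpr fun Q' hQ' hle => ?_)
    · rwa [Ne, Ideal.map_eq_bot_iff_of_injective C_injective]
    · exact star.mem_properPrimes_iff (P := Q'.comap C).mp hQ' F hF hF0
        (Ideal.map_le_iff_le_comap.mp hle) h1
  · intro hQ J hJ _ hJQ h1
    exact (one_mem_polynomial_iff star hJ).mp h1 Q hQ hJQ

theorem properPrimesAreQuasiPrime_polynomial [IsFractionRing A L] :
    (star.polynomial L₁).ProperPrimesAreQuasiPrime := by
  intro Q hQ hQ0
  rw [properPrimes_polynomial] at hQ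
  refine ⟨Q.isPrime, isQuasiIdeal_of_le _ hQ0 fun x hx => ?_⟩
  obtain ⟨s, hs, hsx⟩ := mem_nagata.mp hx
  obtain ⟨i, hi⟩ : ∃ i, s.coeff i ∉ Q.asIdeal := by
    simpa only [Ideal.mem_map_C_iff, not_forall] using hs Q hQ
  have hmem : s.coeff i * x ∈ Q.asIdeal := by
    simpa only [Algebra.smul_def, ← map_mul, algebraMap_mem_coeSubmodule] using hsx i
  exact (Q.isPrime.mem_or_mem hmem).resolve_left hi

theorem ProperPrimesAreQuasiPrime.isStrongSDomain [IsDomain A] [IsFractionRing A L]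
    {star : SemistarOperation A L} (hstar : star.ProperPrimesAreQuasiPrime)
    (H : ∀ P ∈ star.properPrimes, IsStrongSPrime P) : star.IsStrongSDomain := by
  intro P₁ P₂ h
  obtain ⟨P₁, rfl⟩ : ∃ P : PrimeSpectrum A, P.asIdeal = P₁ :=
    ⟨⟨P₁, h.left.elim (fun h0 => h0 ▸ Ideal.isPrime_bot) And.left⟩, rfl⟩
  obtain ⟨P₂, rfl⟩ : ∃ P : PrimeSpectrum A, P.asIdeal = P₂ := ⟨⟨P₂, h.right.1⟩, rfl⟩
  obtain ⟨hP₂, h12⟩ := hstar.isAdjacent_iff.mp h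
  refine (star.properPrimesAreQuasiPrime_polynomial.isAdjacent_iff (P₁ := polynomialExtension P₁)
    (P₂ := polynomialExtension P₂)).mpr ⟨?_, H P₂ hP₂ P₁ h12⟩
  rwa [properPrimes_polynomial, Set.mem_preimage, comap_C_polynomialExtension]

theorem ProperPrimesAreQuasiPrime.isStrongSDomainAfter {A L : Type u} [CommRing A] [IsDomain A]
    [Field L] [Algebra A L] [IsFractionRing A L] {star : SemistarOperation A L}
    (hstar : star.ProperPrimesAreQuasiPrime)
    (H : ∀ P ∈ star.properPrimes, IsUniversallyStrongSPrime P) (n : ℕ) :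
    IsStrongSDomainAfter n star := by
  induction n generalizing A L with
  | zero => exact hstar.isStrongSDomain fun P hP => (H P hP).isStrongSPrime
  | succ _ ih =>
    refine ih star.properPrimesAreQuasiPrime_polynomial fun P hP => ?_
    rw [properPrimes_polynomial] at hP
    exact (H _ hP).of_comap_C

theorem IsQuasiPruferDomain.isQuasiPruferPrime {star : SemistarOperation A L}
    (h : star.IsQuasiPruferDomain)
    (hstar : star.ProperPrimesAreQuasiPrime) {P : PrimeSpectrum A} (hP : P ∈ star.properPrimes) :
    IsQuasiPruferPrime P := by
  intro Q hQP
  refine PrimeSpectrum.ext ?_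
  by_cases hP0 : P.asIdeal = ⊥
  · have hQ0 : Q.asIdeal = ⊥ := by
      rw [← le_bot_iff, ← Ideal.map_bot (f := (C : A →+* A[X])), ← hP0]
      exact hQP
    change Q.asIdeal = (Q.asIdeal.comap C).map C
    rw [hQ0, Ideal.comap_bot_of_injective _ C_injective, Ideal.map_bot]
  · exact h Q.asIdeal Q.isPrime P.asIdeal (hstar P hP hP0) hQP

end Polynomial

section Tilde

variable {A : Type u} {L : Type v} [CommRing A] [IsDomain A] [Field L] [Algebra A L]
  [IsFractionRing A L]

variable {star : SemistarOperation A L}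

theorem mem_tilde {E : Submodule A L} {x : L} :
    x ∈ star.tilde E ↔
      ∀ M : Ideal A, star.finiteType.IsQuasiMaximal M → ∃ s : A, s ∉ M ∧ s • x ∈ E := by
  change x ∈ (⨅ P ∈ {P : PrimeSpectrum A | star.finiteType.IsQuasiMaximal P.asIdeal},
    localize E P) ↔ _
  simp only [Submodule.mem_iInf]
  exact ⟨fun h M hM => h ⟨M, hM.isPrime⟩ hM, fun h P hP => h P.asIdeal hP⟩

theorem IsQuasiMaximal.isQuasiIdeal_tilde {M : Ideal A} (hM : star.finiteType.IsQuasiMaximal M)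
    {I : Ideal A} (hI : I ≠ ⊥) (h : ∀ s ∉ M, ∀ x, s * x ∈ I → x ∈ I) :
    star.tilde.IsQuasiIdeal I := by
  refine isQuasiIdeal_of_le _ hI fun x hx => ?_
  obtain ⟨s, hsM, hs⟩ := mem_tilde.mp hx M hM
  rw [Algebra.smul_def, ← map_mul, algebraMap_mem_coeSubmodule] at hs
  exact h s hsM x hs

theorem exists_le_isQuasiMaximal_of_mem_properPrimes_tilde {P : PrimeSpectrum A}
    (hP : P ∈ star.tilde.properPrimes) (hP0 : P.asIdeal ≠ ⊥) :
    ∃ M, star.finiteType.IsQuasiMaximal M ∧ P.asIdeal ≤ M := by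
  refine exists_le_isQuasiMaximal_finiteType star hP0 fun h1 => ?_
  obtain ⟨J, hJ, hJ0, hJP, h1⟩ := (one_mem_finiteType_iff star hP0).mp h1
  refine star.tilde.mem_properPrimes_iff.mp hP J hJ hJ0 hJP (mem_tilde.mpr fun M hM => ?_)
  have hJM : ¬ J ≤ M := fun hle => hM.prop.1 <| hM.prop.2.one_mem_iff.mp <|
    (one_mem_finiteType_iff star hM.prop.2.1).mpr ⟨J, hJ, hJ0, hle, h1⟩
  obtain ⟨s, hsJ, hsM⟩ := SetLike.not_le_iff_exists.mp hJM
  refine ⟨s, hsM, ?_⟩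
  rw [Algebra.smul_def, mul_one]
  exact algebraMap_mem_coeSubmodule.mpr hsJ

theorem properPrimesAreQuasiPrime_tilde (star : SemistarOperation A L) :
    star.tilde.ProperPrimesAreQuasiPrime := by
  intro P hP hP0
  obtain ⟨M, hM, hPM⟩ := exists_le_isQuasiMaximal_of_mem_properPrimes_tilde hP hP0
  exact ⟨P.isPrime, hM.isQuasiIdeal_tilde hP0 fun s hs x hx =>
    (P.isPrime.mem_or_mem hx).resolve_left fun h => hs (hPM h)⟩

theorem IsNoetherianDomain.isNoetherianRing_localization (hN : star.tilde.IsNoetherianDomain)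
    {P : PrimeSpectrum A} (hP : P ∈ star.tilde.properPrimes) :
    IsNoetherianRing (Localization.AtPrime P.asIdeal) := by
  obtain rfl | hP0 : P = ⊥ ∨ P.asIdeal ≠ ⊥ :=
    (eq_or_ne P.asIdeal ⊥).imp_left fun h => PrimeSpectrum.ext h
  · exact isNoetherianRing_localization_bot A
  obtain ⟨M, hM, hPM⟩ := exists_le_isQuasiMaximal_of_mem_properPrimes_tilde hP hP0
  let e := IsLocalization.orderEmbedding P.asIdeal.primeCompl (Localization.AtPrime P.asIdeal)
  have hquasi (J : Ideal (Localization.AtPrime P.asIdeal)) (hJ : e J ≠ ⊥) :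
      star.tilde.IsQuasiIdeal (e J) := by
    refine hM.isQuasiIdeal_tilde hJ fun s hs x hx => ?_
    change algebraMap A _ (s * x) ∈ J at hx
    rw [map_mul] at hx
    exact (Ideal.unit_mul_mem_iff_mem J (IsLocalization.map_units _
      (⟨s, fun h => hs (hPM h)⟩ : P.asIdeal.primeCompl))).mp hx
  have hwf : (Set.range e).WellFoundedOn (· > ·) := by
    have hacc : {I | star.tilde.IsQuasiIdeal I}.WellFoundedOn (· > ·) := hN.wf
    refine (hacc.insert ⊥).subset ?_
    rintro _ ⟨J, rfl⟩
    exact or_iff_not_imp_left.mpr (hquasi J)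
  refine isNoetherianRing_iff.mpr (isNoetherian_iff'.mpr ⟨?_⟩)
  exact (Set.wellFoundedOn_range.mp hwf).mono fun _ _ h => e.lt_iff_lt.mpr h

end Tilde

end SemistarOperation

theorem corollary2p6 {D K : Type u} [CommRing D] [IsDomain D] [Field K] [Algebra D K]
    [IsFractionRing D K] (star : SemistarOperation D K) :
    (star.tilde.IsNoetherianDomain → star.tilde.IsStablyStrongSDomain) ∧
      (star.tilde.IsQuasiPruferDomain → star.tilde.IsStablyStrongSDomain) := by
  have hstar := star.properPrimesAreQuasiPrime_tilde
  constructor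
  · intro hN n _
    refine hstar.isStrongSDomainAfter (fun P hP => ?_) n
    have := hN.isNoetherianRing_localization hP
    exact isUniversallyStrongSPrime_of_isNoetherianRing
  · intro hQP n _
    exact hstar.isStrongSDomainAfter
      (fun P hP => (hQP.isQuasiPruferPrime hstar hP).isUniversallyStrongSPrime) n
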